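/- Let $\mathbb T=\mathbb R/2\pi\mathbb Z$ and let $e^{it\varphi(\partial_x/i)}$, $\varphi(\xi)=-\xi|\xi|$, be the propagator of the linear Benjamin–Ono equation $\partial_t u+\mathcal H\partial_{xx}u=0$ on $L^2(\mathbb T)$, where $\widehat{\mathcal H f}(\xi)=-i\,\mathrm{sgn}(\xi)\hat f(\xi)$. For $N\in\{1,2,4,\dots\}$ let $P_N$ be the projection to the frequencies $k\in\mathbb Z$ with $N\le|k|<2N$ (with $|k|<2$ if $N=1$). For a bounded interval $I=[a,b)$, a $U^2(I)$-atom is a function $\sum_{k=1}^{K}\phi_{k-1}\chi_{[t_{k-1},t_k)}$ with $a=t_0<\dots<t_K=b$, $\phi_k\in L^2(\mathbb T)$ and $\sum_k\|\phi_k\|_{L^2}^2=1$; $\|f\|_{U^2(I)}$ is the infimum of $\sum_n|\lambda_n|$ over all representations $f=\sum_{n}\lambda_n a_n$ on $I$ with $U^2(I)$-atoms $a_n$ (and $\infty$ if there is none); and $\|f\|_{DU^2(I)}=\|w\|_{U^2(I)}$, where $\partial_t w=f$ on $(a,b)$ in the sense of distributions and $\lim_{t\uparrow b}w(t)=0$ (and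 $\infty$ if there is no such $w\in U^2(I)$). Put $\|u\|_{U^2_{BO}(I)}=\|e^{-it\varphi(\partial_x/i)}u\|_{U^2(I)}$ and $\|f\|_{DU^2_{BO}(I)}=\|e^{-it\varphi(\partial_x/i)}f\|_{DU^2(I)}$. For $T\in(0,1]$ and $s\in\mathbb R$ define $$\|u\|_{F^s_{BO}(T)}^2=\sum_{N}N^{2s}\sup_{I}\|P_Nu\|_{U^2_{BO}(I)}^2,\qquad \|f\|_{N^s_{BO}(T)}^2=\sum_{N}N^{2s}\sup_{I}\|P_Nf\|_{DU^2_{BO}(I)}^2,$$ where $N$ runs over $\{1,2,4,\dots\}$ and $I=[a,b)$ runs over the intervals $I\subseteq[0,T]$ of length $\min(N^{-1},T)$. Then for every $s>0$ there is a constant $C=C(s)$ such that for all $T\in(0,1]$ and all $u,v:[0,T]\to L^2(\mathbb T)$ $$\|\partial_x(uv)\|_{N^s_{BO}(T)}\le C\,\|u\|_{F^s_{BO}(T)}\|v\|_{F^s_{BO}(T)},$$ $$\|\partial_x(uv)\|_{N^0_{BO}(T)}\le C\,\|u\|_{F^0_{BO}(T)}\|v\|_{F^s_{BO}(T)}$$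 (norms take values in $[0,\infty]$, and $0\cdot\infty=0$). -/

import Mathlib

open MeasureTheory Filter Topology Set
open scoped ENNReal NNReal

noncomputable section

namespace ShortTimeBO

/-! ### Atomic spaces on a bounded interval `[a, b)`, values in a complex normed space -/

section Atomic

variable {E : Type*} [NormedAddCommGroup E] [NormedSpace ℂ E]

/-- `U²`-atoms on `[a, b)`: step functions `∑ φₖ χ_{[tₖ, tₖ₊₁)}` subordinate to a partition
`a = t₀ < ⋯ < t_K = b`, with `∑ ‖φₖ‖² = 1`. -/
def IsU2Atom (a b : ℝ) (A : ℝ → E) : Prop :=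
  ∃ (K : ℕ) (t : Fin (K + 1) → ℝ) (φ : Fin K → E),
    StrictMono t ∧ t 0 = a ∧ t (Fin.last K) = b ∧ ∑ k, ‖φ k‖ ^ 2 = 1 ∧
    A = fun τ => ∑ k, (Ico (t k.castSucc) (t k.succ)).indicator (fun _ => φ k) τ

/-- The norm of `U²([a, b); E)`; it is `∞` when `f` has no atomic representation on `[a, b)`. -/
def U2norm (a b : ℝ) (f : ℝ → E) : ℝ≥0∞ :=
  ⨅ (c : ℕ → ℂ) (A : ℕ → ℝ → E) (_ : ∀ n, IsU2Atom a b (A n))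
    (_ : ∀ τ ∈ Ico a b, HasSum (fun n => c n • A n τ) (f τ)), ∑' n, ‖c n‖ₑ

/-- `∂ₜ w = f` on `(a, b)` in the sense of vector-valued distributions, for a locally integrable
function `f`. -/
def HasDistribDeriv (a b : ℝ) (w f : ℝ → E) : Prop :=
  LocallyIntegrableOn f (Ioo a b) ∧
  ∀ ψ : ℝ → ℝ, ContDiff ℝ (⊤ : ℕ∞) ψ → HasCompactSupport ψ → tsupport ψ ⊆ Ioo a b →
    ∫ τ in Ioo a b, deriv ψ τ • w τ = - ∫ τ in Ioo a b, ψ τ • f τ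

/-- The norm of `DU²([a, b); E)`: the `U²`-norm of the primitive `w` of `f` whose limit at the
right endpoint vanishes (`w` is unique when it exists); it is `∞` when there is no such `w` in
`U²`. -/
def DU2norm (a b : ℝ) (f : ℝ → E) : ℝ≥0∞ :=
  ⨅ (w : ℝ → E) (_ : Tendsto w (𝓝[<] b) (𝓝 0)) (_ : HasDistribDeriv a b w f), U2norm a b w

end Atomic

/-! ### Fourier analysis on the circle `𝕋 = ℝ / 2πℤ` -/

instance factTwoPiPos : Fact (0 < 2 * Real.pi) := ⟨Real.two_pi_pos⟩

/-- `𝕋 = ℝ / 2πℤ`. -/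
abbrev Circ : Type := AddCircle (2 * Real.pi)

/-- `L²(𝕋; ℂ)`, with respect to the normalized Lebesgue measure. -/
abbrev L2T : Type := Lp ℂ 2 (AddCircle.haarAddCircle (T := 2 * Real.pi))

/-- The Benjamin–Ono dispersion relation: `∂ₜu + 𝓗∂ₓₓu = 0` reads `i∂ₜu + φ(∂ₓ/i)u = 0` with
`φ(ξ) = -ξ|ξ|`. -/
def phase (k : ℤ) : ℝ := -((k : ℝ) * |(k : ℝ)|)

lemma memlp_flow (t : ℝ) (f : L2T) :
    Memℓp (fun k : ℤ => Complex.exp (Complex.I * t * phase k) * fourierBasis.repr f k) 2 := by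
  refine (lp.memℓp (fourierBasis.repr f)).mono' ?_
  intro k
  have h : Complex.I * t * phase k = ((t * phase k : ℝ) : ℂ) * Complex.I := by
    push_cast; ring
  rw [norm_mul, h, Complex.norm_exp_ofReal_mul_I, one_mul]

/-- The linear propagator `e^{itφ(∂ₓ/i)}` on `L²(𝕋)`: the Fourier multiplier `e^{itφ(k)}`. -/
def flow (t : ℝ) (f : L2T) : L2T :=
  fourierBasis.repr.symm
    ⟨fun k => Complex.exp (Complex.I * t * phase k) * fourierBasis.repr f k, memlp_flow t f⟩

/-- The frequencies `k ∈ ℤ` seen by `P_N`, `N = 2 ^ j`: `N ≤ |k| < 2N` if `j ≥ 1`, and `|k| < 2`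
if `j = 0`. -/
def freqs (j : ℕ) : Finset ℤ :=
  (Finset.Ioo (-(2 : ℤ) ^ (j + 1)) ((2 : ℤ) ^ (j + 1))).filter
    (fun k => j = 0 ∨ (2 : ℤ) ^ j ≤ |k|)

/-- `P_N g`, `N = 2 ^ j`, for the periodic distribution `g` with Fourier coefficients
`(c k)`: the trigonometric polynomial `∑_{k ∈ freqs j} c k e^{ikx}`. -/
def dyadicProj (j : ℕ) (c : ℤ → ℂ) : L2T := ∑ k ∈ freqs j, c k • fourierLp 2 k

/-! ### The short-time norms, restricted to `[0, T]` -/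

/-- The length of the time intervals for the frequency `N = 2 ^ j`: `N⁻¹`, or `T` if
`[0, T]` is shorter than that. -/
def window (T : ℝ) (j : ℕ) : ℝ := min (((2 : ℝ) ^ j)⁻¹) T

/-- The norm of `F^s_BO(T)`: with `N = 2 ^ j`, the square root of
`∑_N N^{2s} sup_I ‖e^{-itφ(∂ₓ/i)} P_N u‖²_{U²(I; L²)}`, where `I = [a, a + window T j) ⊆ [0, T]`. -/
def FBO (s T : ℝ) (u : ℝ → L2T) : ℝ≥0∞ :=
  (∑' j : ℕ, ((2 : ℝ≥0∞) ^ j) ^ (2 * s) *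
    (⨆ (a : ℝ) (_ : 0 ≤ a) (_ : a + window T j ≤ T),
      U2norm a (a + window T j)
        (fun t => flow (-t) (dyadicProj j (fourierCoeff (u t))))) ^ 2) ^ (1 / 2 : ℝ)

/-- The norm of `N^s_BO(T)`, for a time-dependent periodic distribution `g` given by its
(spatial) Fourier coefficients `g t k`: as `FBO`, with `DU²` in place of `U²`. -/
def NBO (s T : ℝ) (g : ℝ → ℤ → ℂ) : ℝ≥0∞ :=
  (∑' j : ℕ, ((2 : ℝ≥0∞) ^ j) ^ (2 * s) *
    (⨆ (a : ℝ) (_ : 0 ≤ a) (_ : a + window T j ≤ T),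
      DU2norm a (a + window T j)
        (fun t => flow (-t) (dyadicProj j (g t)))) ^ 2) ^ (1 / 2 : ℝ)

/-- The Fourier coefficients of the distribution `∂ₓ(u(t) v(t))`; the product of two
`L²`-functions is in `L¹(𝕋)`. -/
def dxMul (u v : ℝ → L2T) (t : ℝ) (k : ℤ) : ℂ :=
  Complex.I * k * fourierCoeff (fun x : Circ => u t x * v t x) k

end ShortTimeBO

end

/-! In terms of the profiles `e^{-itφ(∂ₓ/i)}u`, `e^{-itφ(∂ₓ/i)}v`, a dyadic block of `∂ₓ(uv)` is a
bilinear multiplier with symbol `ik·e^{-iτΩ}`. The resonance `Ω` is at least the smallest times the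
largest of the three dyadic frequencies, if all three are nonzero blocks (`mul_le_abs_resonance`).
Write `2^j` for the output frequency, and `2^l`, `2^M` for the smallest and largest of the three.

For fixed arguments, integrating `e^{-iτΩ}` over `[c, d)` gains `√((d-c)/(2^l 2^M))`, while Young's
inequality loses `√(2^l)`. The product is `2^j 2^{-M/2} √(d-c)`, with no trace of `l`
(`norm_integral_interaction_le`). A bound by `√(d-c)` passes from constants to pairs of `U²`-atoms
by Cauchy–Schwarz over the common refinement of the two partitions, and thence to `U²`
(`enorm_integral_bilinear_le`).

The `DU²`-norm is reached without duality. Approximating the primitive by step functions on dyadic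
grids and telescoping gives `‖f‖_{DU²} ≤ ∑ₙ 2^{n/2} βₙ`, where `βₙ` bounds the integrals of `f` over
the grid intervals of level `n` (`DU2norm_le`). On a window of length at most `2^{-j}` there are
three ranges of `n`. For `n < M-j` the grid interval may exceed the windows of the inputs; it is cut
into admissible pieces and the weighted terms decay geometrically. For `M-j ≤ n < M-j+l` the
oscillatory bound makes each weighted term `O(1)`. For larger `n` the bound without oscillation
decays geometrically again. Each block thus costs `O(1+l)` (`tsum_levelBound_le`).

This logarithm of the smallest frequency is absorbed by `s > 0`: the regularity `s`, placed on the
lower input frequency, also leaves geometric decay in that frequency and in the distance from the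
higher input to the output (`interactionWeight_le`). Schur's test then sums the blocks. The argument
works with regularity `σ ∈ [0, s]` on the output and on `u`; the two estimates are `σ = s` and `σ =
0`. -/

namespace ShortTimeBO

/-! ### Step functions, atoms and the `U²`-norm -/

section AtomicTheory

variable {E G : Type*} [NormedAddCommGroup E] [NormedSpace ℂ E]
  [NormedAddCommGroup G] [NormedSpace ℂ G]

lemma index_unique {K : ℕ} {t : Fin (K + 1) → ℝ} (ht : StrictMono t) {k l : Fin K} {τ : ℝ}
    (hk : τ ∈ Ico (t k.castSucc) (t k.succ)) (hl : τ ∈ Ico (t l.castSucc) (t l.succ)) : k = l := by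
  have key : ∀ {k l : Fin K}, τ ∈ Ico (t k.castSucc) (t k.succ) →
      τ ∈ Ico (t l.castSucc) (t l.succ) → ¬ k < l := by
    intro k l hk hl hkl
    have h1 : t k.succ ≤ t l.castSucc := ht.monotone (by
      rw [Fin.le_def]; simpa using hkl)
    exact absurd (hk.2.trans_le (h1.trans hl.1)) (lt_irrefl _)
  rcases lt_trichotomy k l with h | h | h
  · exact absurd h (key hk hl)
  · exact h
  · exact absurd h (key hl hk)

lemma sum_step_eq {F : Type*} [AddCommMonoid F] {K : ℕ} {t : Fin (K + 1) → ℝ} (ht : StrictMono t)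
    (φ : Fin K → F) {k : Fin K}
    {τ : ℝ} (hk : τ ∈ Ico (t k.castSucc) (t k.succ)) :
    ∑ l, (Ico (t l.castSucc) (t l.succ)).indicator (fun _ => φ l) τ = φ k := by
  rw [Finset.sum_eq_single k]
  · exact indicator_of_mem hk _
  · intro l _ hl
    exact indicator_of_notMem (fun h => hl (index_unique ht h hk)) _
  · simp

lemma sum_indicator_le_one {K : ℕ} {t : Fin (K + 1) → ℝ} (ht : StrictMono t) (τ : ℝ) :
    ∑ l : Fin K, (Ico (t l.castSucc) (t l.succ)).indicator (fun _ => (1 : ℝ)) τ ≤ 1 := by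
  by_cases h : ∃ k : Fin K, τ ∈ Ico (t k.castSucc) (t k.succ)
  · obtain ⟨k, hk⟩ := h
    rw [sum_step_eq ht (fun _ => (1 : ℝ)) hk]
  · push Not at h
    rw [Finset.sum_eq_zero (fun l _ => indicator_of_notMem (h l) _)]
    exact zero_le_one

lemma IsU2Atom.norm_le {F : Type*} [NormedAddCommGroup F] {a b : ℝ} {A : ℝ → F}
    (hA : IsU2Atom a b A) (τ : ℝ) : ‖A τ‖ ≤ 1 := by
  obtain ⟨K, t, φ, ht, -, -, hφ, rfl⟩ := hA
  by_cases h : ∃ k : Fin K, τ ∈ Ico (t k.castSucc) (t k.succ)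
  · obtain ⟨k, hk⟩ := h
    simp only
    rw [sum_step_eq ht φ hk]
    have : ‖φ k‖ ^ 2 ≤ 1 := by
      rw [← hφ]
      exact Finset.single_le_sum (f := fun k => ‖φ k‖ ^ 2) (fun i _ => by positivity)
        (Finset.mem_univ k)
    exact (sq_le_one_iff₀ (norm_nonneg _)).1 this
  · push Not at h
    simp only
    rw [Finset.sum_eq_zero (fun l _ => indicator_of_notMem (h l) _)]
    simp

lemma IsU2Atom.stronglyMeasurable {F : Type*} [NormedAddCommGroup F] {a b : ℝ} {A : ℝ → F}
    (hA : IsU2Atom a b A) :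
    StronglyMeasurable A := by
  obtain ⟨K, t, φ, -, -, -, -, rfl⟩ := hA
  refine Finset.stronglyMeasurable_fun_sum _ fun k _ => ?_
  exact stronglyMeasurable_const.indicator measurableSet_Ico

/-- An atom exists on every nonempty interval. -/
lemma exists_isU2Atom [Nontrivial E] {a b : ℝ} (hab : a < b) : ∃ A : ℝ → E, IsU2Atom a b A := by
  obtain ⟨x, hx⟩ := exists_norm_eq E (zero_le_one)
  refine ⟨_, 1, ![a, b], ![x], ?_, rfl, rfl, ?_, rfl⟩
  · intro i j hij
    fin_cases i <;> fin_cases j <;> simp_all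
  · simp [hx]

/-- A step function is a multiple of an atom. -/
lemma exists_atom_of_step [Nontrivial E] {a b : ℝ} (hab : a < b) {K : ℕ} {t : Fin (K + 1) → ℝ}
    (ht : StrictMono t) (h0 : t 0 = a) (hK : t (Fin.last K) = b) (φ : Fin K → E) :
    ∃ A : ℝ → E, IsU2Atom a b A ∧ ∀ τ,
      ∑ k, (Ico (t k.castSucc) (t k.succ)).indicator (fun _ => φ k) τ =
        ((√(∑ k, ‖φ k‖ ^ 2) : ℝ) : ℂ) • A τ := by
  set S := ∑ k, ‖φ k‖ ^ 2 with hS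
  have hS0 : 0 ≤ S := Finset.sum_nonneg fun _ _ => by positivity
  -- The zero step function cannot be normalized, so it is written as zero times an arbitrary atom.
  rcases hS0.eq_or_lt with h | h
  · obtain ⟨A, hA⟩ := exists_isU2Atom (E := E) hab
    refine ⟨A, hA, fun τ => ?_⟩
    rw [← h]
    have : ∀ k, φ k = 0 := fun k => by
      have := (Finset.sum_eq_zero_iff_of_nonneg (fun i _ => by positivity)).1 (hS.symm.trans h.symm)
        k (Finset.mem_univ k)
      simpa using this
    simp [this]
  · have hR : 0 < √S := Real.sqrt_pos.2 h
    refine ⟨_, ⟨K, t, fun k => ((√S)⁻¹ : ℂ) • φ k, ht, h0, hK, ?_, rfl⟩, fun τ => ?_⟩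
    · have : ∀ k, ‖((√S)⁻¹ : ℂ) • φ k‖ ^ 2 = S⁻¹ * ‖φ k‖ ^ 2 := fun k => by
        rw [norm_smul, mul_pow, norm_inv, Complex.norm_real, Real.norm_of_nonneg hR.le, inv_pow,
          Real.sq_sqrt hS0]
      simp_rw [this]
      rw [← Finset.mul_sum, ← hS, inv_mul_cancel₀ h.ne']
    · rw [Finset.smul_sum]
      refine Finset.sum_congr rfl fun k _ => ?_
      by_cases hk : τ ∈ Ico (t k.castSucc) (t k.succ)
      · rw [indicator_of_mem hk, indicator_of_mem hk, smul_smul, mul_inv_cancel₀, one_smul]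
        exact_mod_cast hR.ne'
      · rw [indicator_of_notMem hk, indicator_of_notMem hk, smul_zero]

lemma exists_representation {a b : ℝ} {f : ℝ → E} {r : ℝ≥0∞} (h : U2norm a b f < r) :
    ∃ (c : ℕ → ℂ) (A : ℕ → ℝ → E), (∀ n, IsU2Atom a b (A n)) ∧
      (∀ τ ∈ Ico a b, HasSum (fun n => c n • A n τ) (f τ)) ∧ ∑' n, ‖c n‖ₑ < r := by
  simp only [U2norm, iInf_lt_iff] at h
  obtain ⟨c, A, h1, h2, h3⟩ := h
  exact ⟨c, A, h1, h2, h3⟩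

lemma U2norm_le {a b : ℝ} {f : ℝ → E} {c : ℕ → ℂ} {A : ℕ → ℝ → E} (hA : ∀ n, IsU2Atom a b (A n))
    (hf : ∀ τ ∈ Ico a b, HasSum (fun n => c n • A n τ) (f τ)) :
    U2norm a b f ≤ ∑' n, ‖c n‖ₑ :=
  iInf_le_of_le c <| iInf_le_of_le A <| iInf_le_of_le hA <| iInf_le_of_le hf le_rfl

lemma summable_norm_of_tsum_enorm_ne_top {F : Type*} [NormedAddCommGroup F] {c : ℕ → F}
    (h : ∑' n, ‖c n‖ₑ ≠ ∞) : Summable fun n => ‖c n‖ := by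
  have := ENNReal.summable_toReal h
  simpa using this

lemma enorm_le_U2norm {a b : ℝ} (f : ℝ → E) {τ : ℝ} (hτ : τ ∈ Ico a b) :
    ‖f τ‖ₑ ≤ U2norm a b f := by
  refine le_of_forall_gt fun r hr => ?_
  obtain ⟨c, A, hA, hf, hc⟩ := exists_representation hr
  refine lt_of_le_of_lt ?_ hc
  rw [← (hf τ hτ).tsum_eq]
  have hs := summable_norm_of_tsum_enorm_ne_top (hc.trans_le le_top).ne
  have hle : ∀ n, ‖c n • A n τ‖ ≤ ‖c n‖ := fun n => by
    rw [norm_smul]; exact mul_le_of_le_one_right (norm_nonneg _) ((hA n).norm_le τ)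
  have h1 : ‖∑' n, c n • A n τ‖ ≤ ∑' n, ‖c n‖ :=
    tsum_of_norm_bounded hs.hasSum hle
  calc ‖∑' n, c n • A n τ‖ₑ ≤ ENNReal.ofReal (∑' n, ‖c n‖) := by
        rw [← ofReal_norm]; exact ENNReal.ofReal_le_ofReal h1
    _ = ∑' n, ‖c n‖ₑ := by
        rw [ENNReal.ofReal_tsum_of_nonneg (fun _ => norm_nonneg _) hs]
        simp_rw [ofReal_norm]

lemma aestronglyMeasurable_of_U2norm {a b : ℝ} {f : ℝ → E} (h : U2norm a b f ≠ ∞) :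
    AEStronglyMeasurable f (volume.restrict (Ico a b)) := by
  obtain ⟨c, A, hA, hf, -⟩ := exists_representation (lt_top_iff_ne_top.2 h)
  refine aestronglyMeasurable_of_tendsto_ae (f := fun (m : ℕ) τ => ∑ n ∈ Finset.range m, c n • A n τ)
    atTop (fun m => ?_) ?_
  · exact (Finset.stronglyMeasurable_fun_sum _ fun n _ =>
      ((hA n).stronglyMeasurable.const_smul (c n))).aestronglyMeasurable
  · filter_upwards [ae_restrict_mem measurableSet_Ico] with τ hτ
    exact (hf τ hτ).tendsto_sum_nat

/-- A bounded linear functional of `U²`-functions which is bounded on atoms. -/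
lemma enorm_integral_apply_le {a b c d D : ℝ} {K : ℝ≥0} (hcd : Ico c d ⊆ Ico a b)
    {F : ℝ → E →L[ℂ] G}
    (hF : ∀ A : ℝ → E, StronglyMeasurable A →
      AEStronglyMeasurable (fun τ => F τ (A τ)) (volume.restrict (Ico c d)))
    (hD0 : 0 ≤ D) (hD : ∀ τ ∈ Ico c d, ∀ x, ‖F τ x‖ ≤ D * ‖x‖)
    (hK : ∀ A : ℝ → E, IsU2Atom a b A → ‖∫ τ in Ico c d, F τ (A τ)‖ₑ ≤ K)
    {f : ℝ → E} (hf : U2norm a b f ≠ ∞) :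
    ‖∫ τ in Ico c d, F τ (f τ)‖ₑ ≤ K * U2norm a b f := by
  have key : ∀ r, U2norm a b f < r → ‖∫ τ in Ico c d, F τ (f τ)‖ₑ ≤ K * r := by
    intro r hr
    obtain ⟨l, A, hA, hl, hs⟩ := exists_representation hr
    have hs1 := summable_norm_of_tsum_enorm_ne_top (hs.trans_le le_top).ne
    have hle : ∀ n, ∀ τ ∈ Ico c d, ‖F τ (l n • A n τ)‖ ≤ ‖l n‖ * D := fun n τ hτ => by
      rw [map_smul, norm_smul]
      gcongr
      exact (hD τ hτ _).trans (mul_le_of_le_one_right hD0 ((hA n).norm_le τ))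
    have hmeas : ∀ n, AEStronglyMeasurable (fun τ => F τ (l n • A n τ))
        (volume.restrict (Ico c d)) := fun n =>
      hF _ ((hA n).stronglyMeasurable.const_smul (l n))
    have hsum : HasSum (fun n => ∫ τ in Ico c d, F τ (l n • A n τ)) (∫ τ in Ico c d, F τ (f τ)) := by
      refine hasSum_integral_of_dominated_convergence (fun n _ => ‖l n‖ * D) hmeas ?_ ?_ ?_ ?_
      · intro n
        filter_upwards [ae_restrict_mem measurableSet_Ico] with τ hτ using hle n τ hτ
      · exact Eventually.of_forall fun _ => hs1.mul_right D
      · exact integrable_const _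
      · filter_upwards [ae_restrict_mem measurableSet_Ico] with τ hτ
        exact (hl τ (hcd hτ)).mapL (F τ)
    have hn : ∀ n, ‖∫ τ in Ico c d, F τ (l n • A n τ)‖ ≤ ‖l n‖ * K := fun n => by
      simp_rw [map_smul]
      rw [integral_smul, norm_smul]
      gcongr
      have := hK (A n) (hA n)
      rw [← ofReal_norm, ENNReal.ofReal_le_coe] at this
      exact_mod_cast this
    have h1 : ‖∫ τ in Ico c d, F τ (f τ)‖ ≤ ∑' n, ‖l n‖ * K := by
      rw [← hsum.tsum_eq]
      exact tsum_of_norm_bounded (hs1.mul_right _).hasSum hn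
    calc ‖∫ τ in Ico c d, F τ (f τ)‖ₑ ≤ ENNReal.ofReal ((∑' n, ‖l n‖) * K) := by
          rw [← ofReal_norm, ← tsum_mul_right]; exact ENNReal.ofReal_le_ofReal h1
      _ = (∑' n, ‖l n‖ₑ) * K := by
          rw [ENNReal.ofReal_mul (tsum_nonneg fun _ => norm_nonneg _),
            ENNReal.ofReal_tsum_of_nonneg (fun _ => norm_nonneg _) hs1]
          simp_rw [ofReal_norm]
          simp
      _ ≤ K * r := by rw [mul_comm]; gcongr
  -- It remains to let `r` decrease to the `U²`-norm. The strict inequality is divided by `K`, which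
  -- may vanish; finiteness of the norm makes the division legitimate in that case.
  by_contra hcon
  push Not at hcon
  have h1 : U2norm a b f < ‖∫ τ in Ico c d, F τ (f τ)‖ₑ / K := by
    rw [ENNReal.lt_div_iff_mul_lt (Or.inr hf) (Or.inl ENNReal.coe_ne_top), mul_comm]
    exact hcon
  obtain ⟨r, hr1, hr2⟩ := exists_between h1
  have h2 := key r hr1
  rw [ENNReal.lt_div_iff_mul_lt (Or.inr (hr2.trans_le le_top).ne) (Or.inl ENNReal.coe_ne_top), mul_comm] at hr2
  exact absurd h2 (not_le.2 hr2)

end AtomicTheory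
-- Transfer of bilinear time integrals to `U²`
section BilinearAtoms

variable {E G : Type*} [NormedAddCommGroup E] [NormedSpace ℂ E]
  [NormedAddCommGroup G] [NormedSpace ℂ G]

lemma aestronglyMeasurable_bilinear {B : ℝ → E →L[ℂ] E →L[ℂ] G}
    (hB : Continuous fun p : ℝ × E × E => B p.1 p.2.1 p.2.2) {μ : Measure ℝ} {z w : ℝ → E}
    (hz : AEStronglyMeasurable z μ) (hw : AEStronglyMeasurable w μ) :
    AEStronglyMeasurable (fun τ => B τ (z τ) (w τ)) μ :=
  hB.comp_aestronglyMeasurable (aestronglyMeasurable_id.prodMk (hz.prodMk hw))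

/-- If the time integrals of a bilinear form, at fixed arguments, are bounded by the square root of
the length of the interval, then so are they along a pair of atoms. -/
lemma norm_integral_atoms_le {B : ℝ → E →L[ℂ] E →L[ℂ] G} 
    (hB : Continuous fun p : ℝ × E × E => B p.1 p.2.1 p.2.2) {L : ℝ}
    (hL0 : 0 ≤ L)
    (hL : ∀ (x y : E) (c d : ℝ), c ≤ d →
      ‖∫ τ in Ico c d, B τ x y‖ ≤ L * √(d - c) * ‖x‖ * ‖y‖)
    {a b a' b' c d : ℝ} (hcd : c ≤ d) {A A' : ℝ → E} (hA : IsU2Atom a b A)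
    (hA' : IsU2Atom a' b' A') :
    ‖∫ τ in Ico c d, B τ (A τ) (A' τ)‖ ≤ L * √(d - c) := by
  obtain ⟨K, t, φ, ht, -, -, hφ, rfl⟩ := hA
  obtain ⟨K', t', φ', ht', -, -, hφ', rfl⟩ := hA'
  set I : Fin K → Set ℝ := fun k => Ico (t k.castSucc) (t k.succ) with hI
  set I' : Fin K' → Set ℝ := fun k => Ico (t' k.castSucc) (t' k.succ) with hI'
  have hexp : ∀ τ, B τ (∑ k, (I k).indicator (fun _ => φ k) τ)
      (∑ k, (I' k).indicator (fun _ => φ' k) τ) =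
      ∑ p : Fin K × Fin K', (I p.1 ∩ I' p.2).indicator (fun σ => B σ (φ p.1) (φ' p.2)) τ := by
    intro τ
    rw [Fintype.sum_prod_type, map_sum (B τ), sum_apply]
    refine Finset.sum_congr rfl fun k _ => ?_
    rw [map_sum]
    refine Finset.sum_congr rfl fun l _ => ?_
    by_cases h1 : τ ∈ I k <;> by_cases h2 : τ ∈ I' l <;> simp [h1, h2]
  have hcont : ∀ x y, Continuous fun τ => B τ x y := fun x y =>
    hB.comp (continuous_id.prodMk (continuous_const (y := (x, y))))
  have hmeas : ∀ p : Fin K × Fin K', MeasurableSet (I p.1 ∩ I' p.2) := fun p =>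
    measurableSet_Ico.inter measurableSet_Ico
  have hint : ∀ p : Fin K × Fin K',
      IntegrableOn ((I p.1 ∩ I' p.2).indicator (fun σ => B σ (φ p.1) (φ' p.2))) (Ico c d) :=
    fun p => (((hcont _ _).integrableOn_Icc).mono_set Ico_subset_Icc_self).indicator (hmeas p)
  set ℓ : Fin K × Fin K' → ℝ := fun p => volume.real (Ico c d ∩ (I p.1 ∩ I' p.2)) with hℓ
  have hterm : ∀ p : Fin K × Fin K',
      ‖∫ τ in Ico c d, (I p.1 ∩ I' p.2).indicator (fun σ => B σ (φ p.1) (φ' p.2)) τ‖ ≤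
        L * (√(ℓ p) * (‖φ p.1‖ * ‖φ' p.2‖)) := by
    intro p
    rw [setIntegral_indicator (hmeas p)]
    have hset : Ico c d ∩ (I p.1 ∩ I' p.2) =
        Ico (max c (max (t p.1.castSucc) (t' p.2.castSucc)))
          (min d (min (t p.1.succ) (t' p.2.succ))) := by
      simp only [hI, hI', Ico_inter_Ico]
    simp only [hℓ]
    rw [hset]
    set c' := max c (max (t p.1.castSucc) (t' p.2.castSucc))
    set d' := min d (min (t p.1.succ) (t' p.2.succ))
    rcases le_total c' d' with h | h
    · rw [Real.volume_real_Ico_of_le h]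
      refine (hL _ _ _ _ h).trans (le_of_eq (by ring))
    · rw [Ico_eq_empty (not_lt.2 h)]
      simp
  -- The cells of the common refinement are disjoint: their indicators add up to at most `1`.
  have hsumℓ : ∑ p, ℓ p ≤ d - c := by
    have h1 : ∀ p, ℓ p = ∫ τ in Ico c d, (I p.1 ∩ I' p.2).indicator (fun _ => (1 : ℝ)) τ := by
      intro p
      rw [setIntegral_indicator (hmeas p)]
      simp [hℓ]
    have hi : ∀ p : Fin K × Fin K',
        IntegrableOn ((I p.1 ∩ I' p.2).indicator (fun _ => (1 : ℝ))) (Ico c d) := fun p =>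
      (integrableOn_const (by simp)).indicator (hmeas p)
    simp_rw [h1]
    rw [← integral_finsetSum _ fun p _ => hi p]
    calc ∫ τ in Ico c d, ∑ p : Fin K × Fin K', (I p.1 ∩ I' p.2).indicator (fun _ => (1 : ℝ)) τ
        ≤ ∫ τ in Ico c d, (1 : ℝ) := by
          refine integral_mono (integrable_finsetSum _ fun p _ => hi p) (integrable_const _) ?_
          intro τ
          have : ∑ p : Fin K × Fin K', (I p.1 ∩ I' p.2).indicator (fun _ => (1 : ℝ)) τ =
              (∑ k, (I k).indicator (fun _ => (1 : ℝ)) τ) *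
                ∑ k, (I' k).indicator (fun _ => (1 : ℝ)) τ := by
            rw [Fintype.sum_mul_sum, Fintype.sum_prod_type]
            refine Finset.sum_congr rfl fun k _ => Finset.sum_congr rfl fun l _ => ?_
            by_cases h1 : τ ∈ I k <;> by_cases h2 : τ ∈ I' l <;> simp [h1, h2]
          simp only [this]
          exact mul_le_one₀ (sum_indicator_le_one ht τ)
            (Finset.sum_nonneg fun k _ => indicator_nonneg (fun _ _ => zero_le_one) _)
            (sum_indicator_le_one ht' τ)
      _ = d - c := by simp [hcd]
  have hexp' := funext hexp
  simp only at hexp' ⊢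
  rw [hexp']
  rw [integral_finsetSum _ fun p _ => hint p]
  calc ‖∑ p : Fin K × Fin K', ∫ τ in Ico c d, (I p.1 ∩ I' p.2).indicator (fun σ => B σ (φ p.1) (φ' p.2)) τ‖
      ≤ ∑ p : Fin K × Fin K', L * (√(ℓ p) * (‖φ p.1‖ * ‖φ' p.2‖)) :=
        (norm_sum_le _ _).trans (Finset.sum_le_sum fun p _ => hterm p)
    _ = L * ∑ p : Fin K × Fin K', √(ℓ p) * (‖φ p.1‖ * ‖φ' p.2‖) := by rw [Finset.mul_sum]
    -- This is where the square root of the length is essential: the squared factors sum to the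
    -- total length of the cells on one side and to `1 · 1` on the other.
    _ ≤ L * (√(∑ p, √(ℓ p) ^ 2) * √(∑ p : Fin K × Fin K', (‖φ p.1‖ * ‖φ' p.2‖) ^ 2)) := by
        gcongr
        exact Real.sum_mul_le_sqrt_mul_sqrt _ _ _
    _ = L * √(∑ p, ℓ p) := by
        congr 1
        have h1 : ∑ p : Fin K × Fin K', (‖φ p.1‖ * ‖φ' p.2‖) ^ 2 = 1 := by
          simp_rw [mul_pow]
          rw [Fintype.sum_prod_type]
          simp only
          rw [← Fintype.sum_mul_sum, hφ, hφ', one_mul]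
        rw [h1, Real.sqrt_one, mul_one]
        congr 1
        refine Finset.sum_congr rfl fun p _ => Real.sq_sqrt measureReal_nonneg
    _ ≤ L * √(d - c) := by gcongr

/-- The estimate of `norm_integral_atoms_le` for general elements of `U²`. -/
lemma enorm_integral_bilinear_le {B : ℝ → E →L[ℂ] E →L[ℂ] G} 
    (hB : Continuous fun p : ℝ × E × E => B p.1 p.2.1 p.2.2) {L : ℝ≥0}
    {D : ℝ} (hD0 : 0 ≤ D)
    (hD : ∀ τ x y, ‖B τ x y‖ ≤ D * ‖x‖ * ‖y‖)
    (hL : ∀ (x y : E) (c d : ℝ), c ≤ d →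
      ‖∫ τ in Ico c d, B τ x y‖ ≤ L * √(d - c) * ‖x‖ * ‖y‖)
    {a b a' b' c d : ℝ} (hcd : c ≤ d) (h1 : Ico c d ⊆ Ico a b) (h2 : Ico c d ⊆ Ico a' b')
    {x y : ℝ → E} (hx : U2norm a b x ≠ ∞) (hy : U2norm a' b' y ≠ ∞) :
    ‖∫ τ in Ico c d, B τ (x τ) (y τ)‖ₑ ≤
      ENNReal.ofReal (L * √(d - c)) * U2norm a b x * U2norm a' b' y := by
  have hxm : AEStronglyMeasurable x (volume.restrict (Ico c d)) :=
    (aestronglyMeasurable_of_U2norm hx).mono_set h1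
  set K : ℝ≥0 := L * NNReal.sqrt (d - c).toNNReal with hK
  have hK2 : (K : ℝ) = L * √(d - c) := by
    rw [hK, NNReal.coe_mul, Real.coe_sqrt, Real.coe_toNNReal _ (sub_nonneg.2 hcd)]
  have hK1 : ENNReal.ofReal (L * √(d - c)) = K := by
    rw [← hK2, ENNReal.ofReal_coe_nnreal]
  -- Two applications of the linear extension: with the second argument frozen at an atom, the first
  -- runs over `U²`; then the first is frozen and the second runs over `U²`.
  have first : ∀ A' : ℝ → E, IsU2Atom a' b' A' →
      ‖∫ τ in Ico c d, B τ (x τ) (A' τ)‖ₑ ≤ K * U2norm a b x := by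
    intro A' hA'
    refine enorm_integral_apply_le (F := fun τ => (B τ).flip (A' τ)) h1 (D := D) ?_ hD0 ?_ ?_ hx
    · intro A hA
      exact aestronglyMeasurable_bilinear hB hA.aestronglyMeasurable
        hA'.stronglyMeasurable.aestronglyMeasurable
    · intro τ hτ z
      refine (hD τ z (A' τ)).trans ?_
      exact mul_le_of_le_one_right (by positivity) (hA'.norm_le τ)
    · intro A hA
      have := norm_integral_atoms_le hB L.2 hL hcd hA hA'
      rw [← ofReal_norm, ENNReal.ofReal_le_coe, hK2]
      exact this
  have hxf := ENNReal.coe_toNNReal hx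
  rw [hK1]
  have := enorm_integral_apply_le (F := fun τ => B τ (x τ)) (f := y) h2
    (D := D * (U2norm a b x).toReal) (K := K * (U2norm a b x).toNNReal) ?_ (by positivity)
    ?_ ?_ hy
  · rwa [ENNReal.coe_mul, hxf] at this
  · intro A hA
    exact aestronglyMeasurable_bilinear hB hxm hA.aestronglyMeasurable
  · intro τ hτ z
    refine (hD τ (x τ) z).trans ?_
    gcongr
    have := ENNReal.toReal_mono hx (enorm_le_U2norm x (h1 hτ))
    simpa using this
  · intro A' hA'
    rw [ENNReal.coe_mul, hxf]
    exact first A' hA'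

end BilinearAtoms
-- Dyadic control of the `DU²`-norm
section Primitive

variable {E : Type*} [NormedAddCommGroup E] [NormedSpace ℂ E]

/-- The `i`-th point of the dyadic grid of level `n` in `[a, b]`. -/
noncomputable def grid (a b : ℝ) (n i : ℕ) : ℝ := a + i * ((b - a) / 2 ^ n)

lemma grid_zero (a b : ℝ) (n : ℕ) : grid a b n 0 = a := by simp [grid]

lemma grid_last (a b : ℝ) (n : ℕ) : grid a b n (2 ^ n) = b := by
  simp only [grid]; push_cast; field_simp; ring

lemma grid_succ_level (a b : ℝ) (n i : ℕ) : grid a b (n + 1) (2 * i) = grid a b n i := by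
  simp only [grid]; push_cast; rw [pow_succ]; field_simp

lemma grid_succ_sub (a b : ℝ) (n i : ℕ) :
    grid a b n (i + 1) - grid a b n i = (b - a) / 2 ^ n := by
  simp only [grid]; push_cast; ring

lemma grid_strictMono {a b : ℝ} (hab : a < b) (n : ℕ) : StrictMono (grid a b n) := by
  refine strictMono_nat_of_lt_succ fun i => ?_
  have h : 0 < (b - a) / 2 ^ n := div_pos (sub_pos.2 hab) (by positivity)
  have := grid_succ_sub a b n i
  linarith

lemma grid_mem_Icc {a b : ℝ} (hab : a < b) {n i : ℕ} (hi : i ≤ 2 ^ n) :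
    grid a b n i ∈ Icc a b := by
  constructor
  · exact (grid_zero a b n).ge.trans ((grid_strictMono hab n).monotone (Nat.zero_le i))
  · exact ((grid_strictMono hab n).monotone hi).trans (grid_last a b n).le

/-- The index of the dyadic interval of level `n` that contains `τ`. -/
noncomputable def gridIndex (a b : ℝ) (n : ℕ) (τ : ℝ) : ℕ := ⌊(τ - a) / (b - a) * 2 ^ n⌋₊

lemma gridIndex_succ_div (a b : ℝ) (n : ℕ) (τ : ℝ) :
    gridIndex a b (n + 1) τ / 2 = gridIndex a b n τ := by
  simp only [gridIndex]
  rw [← Nat.floor_div_ofNat]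
  congr 1
  rw [pow_succ]; ring

lemma gridIndex_lt {a b τ : ℝ} (n : ℕ) (hτ : τ ∈ Ico a b) : gridIndex a b n τ < 2 ^ n := by
  have hab : 0 < b - a := sub_pos.2 (hτ.1.trans_lt hτ.2)
  simp only [gridIndex]
  rw [Nat.floor_lt (mul_nonneg (div_nonneg (sub_nonneg.2 hτ.1) hab.le) (by positivity))]
  push_cast
  have h1 : (τ - a) / (b - a) < 1 := by rw [div_lt_one hab]; linarith [hτ.2]
  exact mul_lt_of_lt_one_left (by positivity) h1

lemma mem_grid_gridIndex {a b τ : ℝ} (n : ℕ) (hτ : τ ∈ Ico a b) :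
    τ ∈ Ico (grid a b n (gridIndex a b n τ)) (grid a b n (gridIndex a b n τ + 1)) := by
  have hab : 0 < b - a := sub_pos.2 (hτ.1.trans_lt hτ.2)
  have h0 : 0 ≤ (τ - a) / (b - a) * 2 ^ n :=
    mul_nonneg (div_nonneg (sub_nonneg.2 hτ.1) hab.le) (by positivity)
  have e : (τ - a) / (b - a) * 2 ^ n * ((b - a) / 2 ^ n) = τ - a := by field_simp
  have hp : 0 < (b - a) / 2 ^ n := div_pos hab (by positivity)
  constructor
  · have := mul_le_mul_of_nonneg_right (Nat.floor_le h0) hp.le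
    rw [e] at this
    simp only [grid, gridIndex]; linarith
  · have := mul_lt_mul_of_pos_right (Nat.lt_floor_add_one ((τ - a) / (b - a) * 2 ^ n)) hp
    rw [e] at this
    simp only [grid, gridIndex]; push_cast; linarith

lemma tendsto_grid_gridIndex {a b τ : ℝ} (hτ : τ ∈ Ico a b) :
    Tendsto (fun n => grid a b n (gridIndex a b n τ + 1)) atTop (𝓝 τ) := by
  have h0 : Tendsto (fun n : ℕ => τ + (b - a) / 2 ^ n) atTop (𝓝 (τ + 0)) := by
    refine tendsto_const_nhds.add ?_
    have := (tendsto_pow_atTop_nhds_zero_of_lt_one (r := (1 / 2 : ℝ)) (by norm_num)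
      (by norm_num)).const_mul (b - a)
    simpa [div_eq_mul_inv] using this
  rw [add_zero] at h0
  refine tendsto_of_tendsto_of_tendsto_of_le_of_le tendsto_const_nhds h0 (fun n => ?_) fun n => ?_
  · exact (mem_grid_gridIndex n hτ).2.le
  · have h1 := (mem_grid_gridIndex n hτ).1
    have h2 := grid_succ_sub a b n (gridIndex a b n τ)
    simp only
    linarith

lemma primitive_sub {a b : ℝ} {f : ℝ → E} (hf : IntegrableOn f (Icc a b)) {c d : ℝ}
    (hc : c ∈ Icc a b) (hd : d ∈ Icc a b) (hcd : c ≤ d) :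
    (-∫ τ in c..b, f τ) - (-∫ τ in d..b, f τ) = -∫ τ in Ico c d, f τ := by
  have hi : ∀ {x y}, x ∈ Icc a b → y ∈ Icc a b → IntervalIntegrable f volume x y := by
    intro x y hx hy
    exact (hf.mono_set (uIcc_subset_Icc hx hy)).intervalIntegrable
  have hb : b ∈ Icc a b := ⟨hc.1.trans hc.2, le_rfl⟩
  rw [integral_Ico_eq_integral_Ioc, ← intervalIntegral.integral_of_le hcd,
    ← intervalIntegral.integral_add_adjacent_intervals (hi hc hd) (hi hd hb)]
  abel

/-- The `U²`-norm of a primitive is controlled by the integrals over dyadic intervals. -/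
lemma U2norm_primitive_le [CompleteSpace E] [Nontrivial E] {a b : ℝ} (hab : a < b) {f : ℝ → E}
    (hf : IntegrableOn f (Icc a b)) {β : ℕ → ℝ≥0∞}
    (hβ : ∀ n i, i < 2 ^ n →
      ‖∫ τ in Ico (grid a b n i) (grid a b n (i + 1)), f τ‖ₑ ≤ β n) :
    U2norm a b (fun t => -∫ τ in t..b, f τ) ≤ ∑' n, ENNReal.ofReal √(2 ^ n) * β n := by
  rcases eq_or_ne (∑' n, ENNReal.ofReal √(2 ^ n) * β n) ∞ with htop | htop
  · rw [htop]; exact le_top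
  set w : ℝ → E := fun t => -∫ τ in t..b, f τ with hw
  have hβtop : ∀ n, β n ≠ ∞ := fun n h => by
    refine ENNReal.ne_top_of_tsum_ne_top htop n ?_
    rw [h, ENNReal.mul_top]
    simp
  -- The level `n` approximation of `w` takes on each grid interval the value of `w` at the right
  -- endpoint. The increment to level `n + 1` on the interval `i` compares its right endpoint with
  -- that of its parent `i / 2`.
  set φ : (n : ℕ) → Fin (2 ^ (n + 1)) → E := fun n i =>
    w (grid a b (n + 1) (i + 1)) - w (grid a b n (i / 2 + 1)) with hφ
  have hφle : ∀ n i, ‖φ n i‖ ≤ (β (n + 1)).toReal := by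
    intro n i
    have hi := i.2
    -- A left child (`i` even) differs from its parent by the integral over its sibling `i + 1`; a
    -- right child shares the right endpoint, so the increment vanishes.
    rcases Nat.even_or_odd' (i : ℕ) with ⟨q, hq | hq⟩
    · have h1 : (i : ℕ) / 2 + 1 = q + 1 := by omega
      have h2 : grid a b n (q + 1) = grid a b (n + 1) (i + 1 + 1) := by
        rw [← grid_succ_level, hq]; ring_nf
      have hlt : (i : ℕ) + 1 < 2 ^ (n + 1) := by
        have := pow_succ 2 n; omega
      simp only [hφ]
      rw [h1, h2, hw]
      simp only
      rw [primitive_sub hf (grid_mem_Icc hab hlt.le) (grid_mem_Icc hab hlt)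
        ((grid_strictMono hab _).monotone (Nat.le_succ _)), norm_neg]
      have := ENNReal.toReal_mono (hβtop _) (hβ (n + 1) (i + 1) hlt)
      simpa using this
    · have h1 : (i : ℕ) / 2 + 1 = q + 1 := by omega
      have h2 : grid a b n (q + 1) = grid a b (n + 1) (i + 1) := by
        rw [← grid_succ_level, hq]; ring_nf
      simp only [hφ]
      rw [h1, h2, sub_self, norm_zero]
      exact ENNReal.toReal_nonneg
  have hex : ∀ n, ∃ A : ℝ → E, IsU2Atom a b A ∧ ∀ τ ∈ Ico a b,
      w (grid a b (n + 1) (gridIndex a b (n + 1) τ + 1)) - w (grid a b n (gridIndex a b n τ + 1)) =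
        ((√(∑ k, ‖φ n k‖ ^ 2) : ℝ) : ℂ) • A τ := by
    intro n
    have ht : StrictMono fun i : Fin (2 ^ (n + 1) + 1) => grid a b (n + 1) i :=
      (grid_strictMono hab (n + 1)).comp Fin.val_strictMono
    obtain ⟨A, hA, hAτ⟩ := exists_atom_of_step hab ht (by simp [grid_zero])
      (by simp only [Fin.val_last]; exact grid_last a b (n + 1)) (φ n)
    refine ⟨A, hA, fun τ hτ => ?_⟩
    rw [← hAτ τ]
    have hk := sum_step_eq ht (φ n) (k := ⟨gridIndex a b (n + 1) τ, gridIndex_lt (n + 1) hτ⟩)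
      (τ := τ) (by simpa using mem_grid_gridIndex (n + 1) hτ)
    rw [hk]
    simp only [hφ]
    rw [gridIndex_succ_div]
  choose A hA hAτ using hex
  set c : ℕ → ℂ := fun n => ((√(∑ k, ‖φ n k‖ ^ 2) : ℝ) : ℂ) with hc
  have hcle : ∀ n, ‖c n‖ₑ ≤ ENNReal.ofReal √(2 ^ (n + 1)) * β (n + 1) := by
    intro n
    have h1 : ∑ k, ‖φ n k‖ ^ 2 ≤ 2 ^ (n + 1) * (β (n + 1)).toReal ^ 2 := by
      calc ∑ k, ‖φ n k‖ ^ 2 ≤ ∑ k : Fin (2 ^ (n + 1)), (β (n + 1)).toReal ^ 2 := by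
            gcongr with k _
            exact hφle n k
        _ = _ := by simp
    have h2 : √(∑ k, ‖φ n k‖ ^ 2) ≤ √(2 ^ (n + 1)) * (β (n + 1)).toReal := by
      refine (Real.sqrt_le_sqrt h1).trans (le_of_eq ?_)
      rw [Real.sqrt_mul (by positivity), Real.sqrt_sq ENNReal.toReal_nonneg]
    rw [← ofReal_norm, hc, Complex.norm_real, Real.norm_of_nonneg (Real.sqrt_nonneg _)]
    refine (ENNReal.ofReal_le_ofReal h2).trans (le_of_eq ?_)
    rw [ENNReal.ofReal_mul (Real.sqrt_nonneg _), ENNReal.ofReal_toReal (hβtop _)]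
  have hctot : ∑' n, ‖c n‖ₑ ≤ ∑' n, ENNReal.ofReal √(2 ^ n) * β n :=
    (ENNReal.tsum_le_tsum hcle).trans
      (ENNReal.tsum_comp_le_tsum_of_injective (add_left_injective 1) fun n =>
        ENNReal.ofReal √(2 ^ n) * β n)
  refine (U2norm_le hA fun τ hτ => ?_).trans hctot
  have hs : Summable fun n => c n • A n τ := by
    refine Summable.of_norm_bounded (g := fun n => ‖c n‖)
      (summable_norm_of_tsum_enorm_ne_top (ne_top_of_le_ne_top htop hctot)) fun n => ?_
    rw [norm_smul]
    exact mul_le_of_le_one_right (norm_nonneg _) ((hA n).norm_le τ)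
  rw [hs.hasSum_iff_tendsto_nat]
  have htel : ∀ m, ∑ n ∈ Finset.range m, c n • A n τ =
      w (grid a b m (gridIndex a b m τ + 1)) := by
    intro m
    -- Sampling at right endpoints makes the level `0` approximation equal to `w b = 0`, so the
    -- telescoping sum has no initial term.
    have h0 : w (grid a b 0 (gridIndex a b 0 τ + 1)) = 0 := by
      have h1 : gridIndex a b 0 τ = 0 := by simpa using gridIndex_lt 0 hτ
      have h2 := grid_last a b 0
      simp only [pow_zero] at h2
      rw [h1, zero_add, h2]
      simp [hw]
    calc ∑ n ∈ Finset.range m, c n • A n τ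
        = ∑ n ∈ Finset.range m, (w (grid a b (n + 1) (gridIndex a b (n + 1) τ + 1)) -
          w (grid a b n (gridIndex a b n τ + 1))) :=
          Finset.sum_congr rfl fun n _ => (hAτ n τ hτ).symm
      _ = _ := by
          rw [Finset.sum_range_sub (fun n => w (grid a b n (gridIndex a b n τ + 1))), h0, sub_zero]
  simp_rw [htel]
  have hcont : ContinuousOn w (Icc a b) := by
    have := intervalIntegral.continuousOn_primitive_interval_left (f := f) (a := a) (b := b)
      (μ := volume) (by rwa [uIcc_of_le hab.le])
    rw [uIcc_of_le hab.le] at this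
    exact this.neg
  refine (hcont τ (Ico_subset_Icc_self hτ)).tendsto.comp ?_
  refine tendsto_nhdsWithin_of_tendsto_nhds_of_eventually_within _ (tendsto_grid_gridIndex hτ) ?_
  exact Eventually.of_forall fun n => grid_mem_Icc hab (gridIndex_lt n hτ)

/-- Fubini on the triangle `t < τ`: integrating `ψ'` over `(a, τ)` first produces `ψ τ`, since the
support condition forces `ψ a = 0`. -/
lemma hasDistribDeriv_primitive [CompleteSpace E] {a b : ℝ} {f : ℝ → E}
    (hf : IntegrableOn f (Icc a b)) : HasDistribDeriv a b (fun t => -∫ τ in t..b, f τ) f := by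
  have hf' : IntegrableOn f (Ioo a b) := hf.mono_set Ioo_subset_Icc_self
  refine ⟨hf'.locallyIntegrableOn, fun ψ hψ hψc hψs => ?_⟩
  set μ := volume.restrict (Ioo a b) with hμ
  have hψd : Continuous (deriv ψ) := hψ.continuous_deriv (by simp)
  have hdi : Integrable (deriv ψ) μ :=
    (hψd.integrableOn_Icc (a := a) (b := b)).mono_set Ioo_subset_Icc_self
  set F : ℝ → ℝ → E := fun t τ =>
    {p : ℝ × ℝ | p.1 < p.2}.indicator (fun p => deriv ψ p.1 • f p.2) (t, τ) with hF
  have hFi : Integrable (Function.uncurry F) (μ.prod μ) :=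
    (hdi.smul_prod hf').indicator (measurableSet_lt measurable_fst measurable_snd)
  have hψa : ψ a = 0 := by
    by_contra h
    exact (lt_irrefl a) (hψs (subset_tsupport ψ h)).1
  have h1 : ∀ t ∈ Ioo a b, deriv ψ t • (-∫ τ in t..b, f τ) = -∫ τ, F t τ ∂μ := by
    intro t ht
    have : ∀ τ, F t τ = (Ioi t).indicator (fun τ => deriv ψ t • f τ) τ := fun τ => by
      by_cases h : t < τ <;> simp [hF, h]
    simp_rw [this]
    rw [hμ, setIntegral_indicator measurableSet_Ioi, integral_smul, smul_neg,
      intervalIntegral.integral_of_le ht.2.le, integral_Ioc_eq_integral_Ioo]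
    have : Ioo a b ∩ Ioi t = Ioo t b := by
      ext τ; simp only [mem_inter_iff, mem_Ioo, mem_Ioi]
      exact ⟨fun h => ⟨h.2, h.1.2⟩, fun h => ⟨⟨ht.1.trans h.1, h.2⟩, h.1⟩⟩
    rw [this]
  have h2 : ∀ τ ∈ Ioo a b, ∫ t, F t τ ∂μ = ψ τ • f τ := by
    intro τ hτ
    have : ∀ t, F t τ = (Iio τ).indicator (fun t => deriv ψ t • f τ) t := fun t => by
      by_cases h : t < τ <;> simp [hF, h]
    simp_rw [this]
    rw [hμ, setIntegral_indicator measurableSet_Iio, integral_smul_const]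
    have hset : Ioo a b ∩ Iio τ = Ioo a τ := by
      ext t; simp only [mem_inter_iff, mem_Ioo, mem_Iio]
      exact ⟨fun h => ⟨h.1.1, h.2⟩, fun h => ⟨⟨h.1, h.2.trans hτ.2⟩, h.2⟩⟩
    rw [hset, ← integral_Ioc_eq_integral_Ioo, ← intervalIntegral.integral_of_le hτ.1.le,
      intervalIntegral.integral_deriv_eq_sub
        (fun x _ => (hψ.differentiable (by simp)) x) (hψd.intervalIntegrable _ _), hψa, sub_zero]
  rw [setIntegral_congr_fun measurableSet_Ioo h1, integral_neg, integral_integral_swap hFi,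
    setIntegral_congr_fun measurableSet_Ioo h2]

/-- The `DU²`-norm is controlled by the integrals over dyadic intervals. -/
lemma DU2norm_le [CompleteSpace E] [Nontrivial E] {a b : ℝ} (hab : a < b) {f : ℝ → E}
    (hf : IntegrableOn f (Icc a b)) {β : ℕ → ℝ≥0∞}
    (hβ : ∀ n i, i < 2 ^ n →
      ‖∫ τ in Ico (grid a b n i) (grid a b n (i + 1)), f τ‖ₑ ≤ β n) :
    DU2norm a b f ≤ ∑' n, ENNReal.ofReal √(2 ^ n) * β n := by
  refine iInf_le_of_le (fun t => -∫ τ in t..b, f τ) <| iInf_le_of_le ?_ <|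
    iInf_le_of_le (hasDistribDeriv_primitive hf) (U2norm_primitive_le hab hf hβ)
  have := intervalIntegral.continuousOn_primitive_interval_left (f := f) (a := a) (b := b)
      (μ := volume) (by rwa [uIcc_of_le hab.le])
  rw [uIcc_of_le hab.le] at this
  have h1 := (this.neg b (right_mem_Icc.2 hab.le)).tendsto
  simp only [intervalIntegral.integral_same, neg_zero, Pi.neg_apply] at h1
  refine h1.mono_left ?_
  rw [← nhdsWithin_Ioo_eq_nhdsLT hab]
  exact nhdsWithin_mono _ Ioo_subset_Icc_self

end Primitive
-- Resonance function and oscillatory integrals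
section Resonance

/-- The resonance function of the interaction `p + (k - p) = k`. -/
noncomputable def resonance (k p : ℤ) : ℝ := phase k - phase p - phase (k - p)

/-- Among `|x|`, `|y|`, `|x + y|` the largest is the sum `p + q` of the two others, and the
expression equals `±2pq`. As `p, q ≥ m`, this is at least `m (p + q) ≥ m M`. The two sign patterns
that force `x = y = 0` are degenerate. -/
lemma mul_le_abs_resonance_aux {x y m M : ℝ} (hm : 0 ≤ m) (hx : m ≤ |x|) (hy : m ≤ |y|)
    (hxy : m ≤ |x + y|) (hM : M ≤ |x| ∨ M ≤ |y| ∨ M ≤ |x + y|) :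
    m * M ≤ abs ((x + y) * |x + y| - x * |x| - y * |y|) := by
  have key : ∀ p q : ℝ, m ≤ p → m ≤ q → M ≤ p + q → m * M ≤ 2 * (p * q) := by
    intro p q hp hq hpq
    have h1 : m * M ≤ m * (p + q) := mul_le_mul_of_nonneg_left hpq hm
    nlinarith [mul_nonneg (hm.trans hp) (sub_nonneg.2 hq),
      mul_nonneg (hm.trans hq) (sub_nonneg.2 hp)]
  rcases le_total 0 x with h1 | h1 <;> rcases le_total 0 y with h2 | h2 <;>
    rcases le_total 0 (x + y) with h3 | h3
  all_goals
    simp only [abs_of_nonneg, abs_of_nonpos, h1, h2, h3] at hx hy hxy hM ⊢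
  · refine (key x y hx hy (by rcases hM with h | h | h <;> linarith)).trans ?_
    exact le_trans (le_of_eq (by ring)) (le_abs_self _)
  · have : x = 0 := by linarith
    have : y = 0 := by linarith
    subst x; subst y
    have := key 0 0 (by linarith) (by linarith) (by rcases hM with h | h | h <;> linarith)
    exact this.trans (by simp)
  · refine (key (x + y) (-y) hxy hy (by rcases hM with h | h | h <;> linarith)).trans ?_
    rw [← abs_neg]
    exact le_trans (le_of_eq (by ring)) (le_abs_self _)
  · refine (key (-(x + y)) x hxy hx (by rcases hM with h | h | h <;> linarith)).trans ?_
    exact le_trans (le_of_eq (by ring)) (le_abs_self _)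
  · refine (key (x + y) (-x) hxy hx (by rcases hM with h | h | h <;> linarith)).trans ?_
    rw [← abs_neg]
    exact le_trans (le_of_eq (by ring)) (le_abs_self _)
  · refine (key (-(x + y)) y hxy hy (by rcases hM with h | h | h <;> linarith)).trans ?_
    exact le_trans (le_of_eq (by ring)) (le_abs_self _)
  · have : x = 0 := by linarith
    have : y = 0 := by linarith
    subst x; subst y
    have := key 0 0 (by linarith) (by linarith) (by rcases hM with h | h | h <;> linarith)
    exact this.trans (by simp)
  · refine (key (-x) (-y) hx hy (by rcases hM with h | h | h <;> linarith)).trans ?_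
    rw [← abs_neg]
    exact le_trans (le_of_eq (by ring)) (le_abs_self _)

lemma mul_le_abs_resonance {k p : ℤ} {m M : ℝ} (hm : 0 ≤ m) (hk : m ≤ |(k : ℝ)|)
    (hp : m ≤ |(p : ℝ)|) (hq : m ≤ |((k - p : ℤ) : ℝ)|)
    (hM : M ≤ |(p : ℝ)| ∨ M ≤ |((k - p : ℤ) : ℝ)| ∨ M ≤ |(k : ℝ)|) :
    m * M ≤ |resonance k p| := by
  have e : ((p : ℝ) + ((k - p : ℤ) : ℝ)) = k := by push_cast; ring
  have := mul_le_abs_resonance_aux (x := p) (y := ((k - p : ℤ) : ℝ)) (M := M) hm hp hq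
    (by rwa [e]) (by rwa [e])
  rw [e] at this
  refine this.trans (le_of_eq ?_)
  rw [← abs_neg, resonance, phase, phase, phase]
  congr 1
  ring

/-- Geometric mean of the trivial bound `d - c` and the bound `2 / |ω|` from integrating the
exponential. -/
lemma norm_integral_exp_le {ω c d : ℝ} (hω : ω ≠ 0) (hcd : c ≤ d) :
    ‖∫ τ in Ico c d, Complex.exp (-(Complex.I * τ * ω))‖ ≤ √(2 * (d - c) / |ω|) := by
  have hdc : 0 ≤ d - c := sub_nonneg.2 hcd
  have hω' : 0 < |ω| := abs_pos.2 hω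
  have hn : ∀ τ : ℝ, ‖Complex.exp (-(Complex.I * τ * ω))‖ = 1 := fun τ => by
    have : -(Complex.I * τ * ω) = ((-(τ * ω) : ℝ) : ℂ) * Complex.I := by push_cast; ring
    rw [this, Complex.norm_exp_ofReal_mul_I]
  have h1 : ‖∫ τ in Ico c d, Complex.exp (-(Complex.I * τ * ω))‖ ≤ d - c := by
    have := norm_setIntegral_le_of_norm_le_const (μ := volume) (s := Ico c d) (C := 1)
      (f := fun τ : ℝ => Complex.exp (-(Complex.I * τ * ω))) (by simp) (fun τ _ => (hn τ).le)
    simpa [hcd] using this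
  have h2 : ‖∫ τ in Ico c d, Complex.exp (-(Complex.I * τ * ω))‖ ≤ 2 / |ω| := by
    have hne : -(Complex.I * ω) ≠ 0 := by
      simp [hω]
    rw [integral_Ico_eq_integral_Ioc, ← intervalIntegral.integral_of_le hcd]
    have e : ∀ τ : ℝ, -(Complex.I * τ * ω) = -(Complex.I * ω) * τ := fun τ => by ring
    simp_rw [e]
    rw [integral_exp_mul_complex hne, norm_div]
    have : ‖-(Complex.I * (ω : ℂ))‖ = |ω| := by simp
    rw [this]
    gcongr
    refine (norm_sub_le _ _).trans ?_
    rw [← e, ← e, hn, hn]; norm_num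
  rw [Real.le_sqrt (norm_nonneg _) (by positivity), sq]
  calc _ ≤ (d - c) * (2 / |ω|) := mul_le_mul h1 h2 (norm_nonneg _) hdc
    _ = _ := by ring

end Resonance
-- Bilinear Fourier multipliers on finite frequency sets
section Fourier

/-- The `k`-th Fourier coefficient, as a functional on `L²`. -/
noncomputable def coeff (k : ℤ) : L2T →L[ℂ] ℂ := innerSL ℂ (fourierLp 2 k : L2T)

lemma coeff_eq_repr (k : ℤ) (x : L2T) : coeff k x = fourierBasis.repr x k := by
  rw [fourierBasis.repr_apply_apply, coe_fourierBasis, coeff, innerSL_apply_apply]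

lemma sum_norm_coeff_sq_le (S : Finset ℤ) (x : L2T) : ∑ k ∈ S, ‖coeff k x‖ ^ 2 ≤ ‖x‖ ^ 2 := by
  simpa [coeff] using (orthonormal_fourier (T := 2 * Real.pi)).sum_inner_products_le x (s := S)

lemma norm_sum_smul_fourierLp_sq (S : Finset ℤ) (c : ℤ → ℂ) :
    ‖∑ k ∈ S, c k • (fourierLp 2 k : L2T)‖ ^ 2 = ∑ k ∈ S, ‖c k‖ ^ 2 := by
  have h := (orthonormal_fourier (T := 2 * Real.pi)).inner_sum c c S
  rw [inner_self_eq_norm_sq_to_K] at h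
  have h2 : ∑ i ∈ S, (starRingEnd ℂ) (c i) * c i = ((∑ k ∈ S, ‖c k‖ ^ 2 : ℝ) : ℂ) := by
    push_cast
    exact Finset.sum_congr rfl fun k _ => Complex.conj_mul' (c k)
  rw [h2] at h
  refine Complex.ofReal_injective (Eq.trans ?_ h)
  push_cast
  rfl

/-- Young's inequality for convolutions of finitely supported sequences. -/
lemma sum_sq_conv_le (S S₁ S₂ : Finset ℤ) (x y : L2T) :
    ∑ k ∈ S, (∑ p ∈ S₁ with k - p ∈ S₂, ‖coeff p x‖ * ‖coeff (k - p) y‖) ^ 2 ≤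
      (min S.card (min S₁.card S₂.card) : ℕ) * (‖x‖ * ‖y‖) ^ 2 := by
  have hy : ∀ k, ∑ p ∈ S₁ with k - p ∈ S₂, ‖coeff (k - p) y‖ ^ 2 ≤ ‖y‖ ^ 2 := by
    intro k
    have : ∑ p ∈ S₁ with k - p ∈ S₂, ‖coeff (k - p) y‖ ^ 2 =
        ∑ q ∈ (S₁.filter (fun p => k - p ∈ S₂)).image (fun p => k - p), ‖coeff q y‖ ^ 2 := by
      rw [Finset.sum_image]
      intro a _ b _ hab
      simpa using hab
    rw [this]
    exact sum_norm_coeff_sq_le _ _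
  -- Cauchy–Schwarz in `p` bounds each output coefficient separately, which costs the number of
  -- outputs.
  have h1 : ∑ k ∈ S, (∑ p ∈ S₁ with k - p ∈ S₂, ‖coeff p x‖ * ‖coeff (k - p) y‖) ^ 2 ≤
      S.card * (‖x‖ * ‖y‖) ^ 2 := by
    rw [← nsmul_eq_mul]
    refine Finset.sum_le_card_nsmul _ _ _ fun k _ => ?_
    calc _ ≤ (∑ p ∈ S₁ with k - p ∈ S₂, ‖coeff p x‖ ^ 2) *
          ∑ p ∈ S₁ with k - p ∈ S₂, ‖coeff (k - p) y‖ ^ 2 :=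
          Finset.sum_mul_sq_le_sq_mul_sq _ _ _
      _ ≤ ‖x‖ ^ 2 * ‖y‖ ^ 2 := by
          gcongr
          · exact sum_norm_coeff_sq_le _ _
          · exact hy k
      _ = _ := by ring
  -- Alternatively the loss is the number of admissible `p` for a given `k`, and the remaining
  -- double sum of squares factorizes.
  have h2 : ∑ k ∈ S, (∑ p ∈ S₁ with k - p ∈ S₂, ‖coeff p x‖ * ‖coeff (k - p) y‖) ^ 2 ≤
      (min S₁.card S₂.card : ℕ) * (‖x‖ * ‖y‖) ^ 2 := by
    have hcard : ∀ k, (S₁.filter (fun p => k - p ∈ S₂)).card ≤ min S₁.card S₂.card := by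
      intro k
      refine le_min (Finset.card_filter_le _ _) ?_
      refine Finset.card_le_card_of_injOn (fun p => k - p) (fun p hp => ?_) ?_
      · exact (Finset.mem_filter.1 hp).2
      · intro a _ b _ hab
        simpa using hab
    calc _ ≤ ∑ k ∈ S, (min S₁.card S₂.card : ℕ) *
          ∑ p ∈ S₁ with k - p ∈ S₂, (‖coeff p x‖ * ‖coeff (k - p) y‖) ^ 2 := by
          refine Finset.sum_le_sum fun k _ => ?_
          refine sq_sum_le_card_mul_sum_sq.trans ?_
          gcongr
          exact hcard k
      _ = (min S₁.card S₂.card : ℕ) *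
          ∑ k ∈ S, ∑ p ∈ S₁ with k - p ∈ S₂, (‖coeff p x‖ * ‖coeff (k - p) y‖) ^ 2 := by
          rw [Finset.mul_sum]
      _ ≤ (min S₁.card S₂.card : ℕ) *
          ∑ k ∈ S, ∑ p ∈ S₁, (‖coeff p x‖ * ‖coeff (k - p) y‖) ^ 2 := by
          gcongr with k _
          exact Finset.filter_subset _ _
      _ ≤ (min S₁.card S₂.card : ℕ) * (‖x‖ * ‖y‖) ^ 2 := by
          gcongr
          rw [Finset.sum_comm]
          simp_rw [mul_pow, ← Finset.mul_sum]
          have : ∀ p, ∑ k ∈ S, ‖coeff (k - p) y‖ ^ 2 ≤ ‖y‖ ^ 2 := by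
            intro p
            have e : ∑ k ∈ S, ‖coeff (k - p) y‖ ^ 2 =
                ∑ q ∈ S.image (fun k => k - p), ‖coeff q y‖ ^ 2 := by
              rw [Finset.sum_image]
              intro a _ b _ hab
              simpa using hab
            rw [e]
            exact sum_norm_coeff_sq_le _ _
          calc ∑ p ∈ S₁, ‖coeff p x‖ ^ 2 * ∑ k ∈ S, ‖coeff (k - p) y‖ ^ 2
              ≤ ∑ p ∈ S₁, ‖coeff p x‖ ^ 2 * ‖y‖ ^ 2 := by
                gcongr with p _
                exact this p
            _ = (∑ p ∈ S₁, ‖coeff p x‖ ^ 2) * ‖y‖ ^ 2 := by rw [Finset.sum_mul]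
            _ ≤ ‖x‖ ^ 2 * ‖y‖ ^ 2 := by
                gcongr
                exact sum_norm_coeff_sq_le _ _
  rcases min_choice S.card (min S₁.card S₂.card) with h | h <;> rw [h]
  · exact h1
  · exact h2

/-- The bilinear Fourier multiplier with symbol `m`, restricted to output frequencies in `S` and
input frequencies in `S₁`, `S₂`. -/
noncomputable def bilinMult (S S₁ S₂ : Finset ℤ) (m : ℤ → ℤ → ℂ) : L2T →L[ℂ] L2T →L[ℂ] L2T :=
  ∑ k ∈ S, ∑ p ∈ S₁ with k - p ∈ S₂,
    m k p • (coeff p).smulRight ((coeff (k - p)).smulRight (fourierLp 2 k : L2T))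

lemma bilinMult_apply (S S₁ S₂ : Finset ℤ) (m : ℤ → ℤ → ℂ) (x y : L2T) :
    bilinMult S S₁ S₂ m x y = ∑ k ∈ S, (∑ p ∈ S₁ with k - p ∈ S₂,
      m k p * (coeff p x * coeff (k - p) y)) • (fourierLp 2 k : L2T) := by
  simp only [bilinMult, sum_apply, _root_.smul_apply,
    ContinuousLinearMap.smulRight_apply, Finset.sum_smul, mul_smul]

lemma norm_bilinMult_le {S S₁ S₂ : Finset ℤ} {m : ℤ → ℤ → ℂ} {D : ℝ}
    (hm : ∀ k ∈ S, ∀ p ∈ S₁, k - p ∈ S₂ → ‖m k p‖ ≤ D) (hD : 0 ≤ D) (x y : L2T) :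
    ‖bilinMult S S₁ S₂ m x y‖ ≤
      D * √(min S.card (min S₁.card S₂.card) : ℕ) * ‖x‖ * ‖y‖ := by
  refine (sq_le_sq₀ (norm_nonneg _) (by positivity)).1 ?_
  rw [bilinMult_apply, norm_sum_smul_fourierLp_sq]
  calc _ ≤ ∑ k ∈ S, (D * ∑ p ∈ S₁ with k - p ∈ S₂, ‖coeff p x‖ * ‖coeff (k - p) y‖) ^ 2 := by
        gcongr with k hk
        rw [Finset.mul_sum]
        refine norm_sum_le_of_le _ fun p hp => ?_
        rw [Finset.mem_filter] at hp
        rw [norm_mul, norm_mul]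
        gcongr
        exact hm k hk p hp.1 hp.2
    _ = D ^ 2 * ∑ k ∈ S, (∑ p ∈ S₁ with k - p ∈ S₂, ‖coeff p x‖ * ‖coeff (k - p) y‖) ^ 2 := by
        simp_rw [mul_pow]; rw [Finset.mul_sum]
    _ ≤ D ^ 2 * ((min S.card (min S₁.card S₂.card) : ℕ) * (‖x‖ * ‖y‖) ^ 2) := by
        gcongr
        exact sum_sq_conv_le S S₁ S₂ x y
    _ = _ := by
        rw [mul_assoc (D * _), mul_pow (D * _), mul_pow D, Real.sq_sqrt (by positivity)]
        ring

end Fourier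
-- Dyadic blocks of the nonlinearity
section Interaction

/-- Since `Nat.log 2 0 = 0`, the frequency `0` falls in the block `j = 0`, so the blocks are the
fibres of one function and partition `ℤ`. -/
lemma mem_freqs {j : ℕ} {k : ℤ} : k ∈ freqs j ↔ Nat.log 2 k.natAbs = j := by
  have e : |k| = (k.natAbs : ℤ) := Int.abs_eq_natAbs k
  have hlt : k ∈ Finset.Ioo (-(2 : ℤ) ^ (j + 1)) (2 ^ (j + 1)) ↔ k.natAbs < 2 ^ (j + 1) := by
    rw [Finset.mem_Ioo, ← abs_lt, e]
    exact_mod_cast Iff.rfl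
  have hle : (2 : ℤ) ^ j ≤ |k| ↔ 2 ^ j ≤ k.natAbs := by
    rw [e]; exact_mod_cast Iff.rfl
  rw [freqs, Finset.mem_filter, hlt, hle]
  rcases eq_or_ne j 0 with rfl | hj
  · rw [Nat.log_eq_zero_iff]
    simp
  · rw [Nat.log_eq_iff (Or.inl hj)]
    simp only [hj, false_or]
    exact and_comm

lemma abs_le_of_mem_freqs {j : ℕ} {k : ℤ} (hk : k ∈ freqs j) : |(k : ℝ)| ≤ 2 ^ (j + 1) := by
  have h := (Finset.mem_filter.1 hk).1
  rw [Finset.mem_Ioo, ← abs_lt] at h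
  exact_mod_cast h.le

lemma le_abs_of_mem_freqs {j : ℕ} (hj : j ≠ 0) {k : ℤ} (hk : k ∈ freqs j) :
    (2 : ℝ) ^ j ≤ |(k : ℝ)| := by
  have h := (Finset.mem_filter.1 hk).2.resolve_left hj
  exact_mod_cast h

lemma card_freqs_le (j : ℕ) : (freqs j).card ≤ 2 ^ (j + 2) := by
  refine (Finset.card_filter_le _ _).trans ?_
  rw [Int.card_Ioo]
  have : (2 : ℤ) ^ (j + 1) - -2 ^ (j + 1) - 1 ≤ ((2 ^ (j + 2) : ℕ) : ℤ) := by
    push_cast; rw [pow_succ _ (j + 1)]; linarith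
  exact Int.toNat_le.2 this

/-- The dyadic triples of frequencies that can interact. -/
def Interacts (j j₁ j₂ : ℕ) : Prop :=
  j ≤ max j₁ j₂ + 1 ∧ j₁ ≤ max j j₂ + 1 ∧ j₂ ≤ max j j₁ + 1

lemma log_natAbs_add_le (a b : ℤ) :
    Nat.log 2 (a + b).natAbs ≤ max (Nat.log 2 a.natAbs) (Nat.log 2 b.natAbs) + 1 := by
  set M := max (Nat.log 2 a.natAbs) (Nat.log 2 b.natAbs) with hM
  have h1 : a.natAbs < 2 ^ (M + 1) :=
    (Nat.lt_pow_succ_log_self one_lt_two _).trans_le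
      (Nat.pow_le_pow_right two_pos (by simp [hM]))
  have h2 : b.natAbs < 2 ^ (M + 1) :=
    (Nat.lt_pow_succ_log_self one_lt_two _).trans_le
      (Nat.pow_le_pow_right two_pos (by simp [hM]))
  have h3 : (a + b).natAbs < 2 ^ (M + 1 + 1) := by
    have := Int.natAbs_add_le a b
    have := pow_succ 2 (M + 1)
    omega
  exact Nat.lt_succ_iff.1 (Nat.log_lt_of_lt_pow' (by omega) h3)

/-- Each of `k`, `p`, `k - p` is, up to signs, the sum of the two others, and a sum raises the
larger dyadic exponent by at most one. -/
lemma interacts_of_mem {j j₁ j₂ : ℕ} {k p : ℤ} (hk : k ∈ freqs j) (hp : p ∈ freqs j₁)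
    (hq : k - p ∈ freqs j₂) : Interacts j j₁ j₂ := by
  rw [mem_freqs] at hk hp hq
  refine ⟨?_, ?_, ?_⟩
  · have := log_natAbs_add_le p (k - p)
    rw [add_sub_cancel] at this
    rwa [hk, hp, hq] at this
  · have := log_natAbs_add_le k (-(k - p))
    rw [Int.natAbs_neg] at this
    have e : k + -(k - p) = p := by ring
    rwa [e, hk, hp, hq] at this
  · have := log_natAbs_add_le k (-p)
    rw [Int.natAbs_neg] at this
    rwa [← sub_eq_add_neg, hk, hp, hq] at this

/-- The symbol of the nonlinear interaction `∂ₓ(uv)` in terms of the profiles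
`e^{-itφ(∂ₓ/i)}u`, `e^{-itφ(∂ₓ/i)}v`. -/
noncomputable def symbol (τ : ℝ) (k p : ℤ) : ℂ :=
  Complex.I * k * Complex.exp (-(Complex.I * τ * resonance k p))

/-- The dyadic block of the interaction `∂ₓ(uv)`. -/
noncomputable def interaction (j j₁ j₂ : ℕ) (τ : ℝ) : L2T →L[ℂ] L2T →L[ℂ] L2T :=
  bilinMult (freqs j) (freqs j₁) (freqs j₂) (symbol τ)

lemma interaction_eq_zero {j j₁ j₂ : ℕ} (h : ¬ Interacts j j₁ j₂) (τ : ℝ) :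
    interaction j j₁ j₂ τ = 0 := by
  rw [interaction, bilinMult]
  refine Finset.sum_eq_zero fun k hk => Finset.sum_eq_zero fun p hp => ?_
  rw [Finset.mem_filter] at hp
  exact absurd (interacts_of_mem hk hp.1 hp.2) h

lemma continuous_symbol (k p : ℤ) : Continuous fun τ => symbol τ k p := by
  unfold symbol; fun_prop

lemma continuous_interaction (j j₁ j₂ : ℕ) :
    Continuous fun q : ℝ × L2T × L2T => interaction j j₁ j₂ q.1 q.2.1 q.2.2 := by
  simp only [interaction, bilinMult_apply]
  refine continuous_finsetSum _ fun k _ => ?_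
  have hc : ∀ p, Continuous fun q : ℝ × L2T × L2T =>
      symbol q.1 k p * (coeff p q.2.1 * coeff (k - p) q.2.2) := fun p =>
    ((continuous_symbol k p).comp continuous_fst).mul
      (((coeff p).continuous.comp (continuous_fst.comp continuous_snd)).mul
        ((coeff (k - p)).continuous.comp (continuous_snd.comp continuous_snd)))
  have hs : Continuous fun q : ℝ × L2T × L2T => ∑ p ∈ freqs j₁ with k - p ∈ freqs j₂,
      symbol q.1 k p * (coeff p q.2.1 * coeff (k - p) q.2.2) :=
    continuous_finsetSum _ fun p _ => hc p
  exact hs.smul continuous_const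

lemma norm_symbol (τ : ℝ) (k p : ℤ) : ‖symbol τ k p‖ = |(k : ℝ)| := by
  have : -(Complex.I * τ * resonance k p) = ((-(τ * resonance k p) : ℝ) : ℂ) * Complex.I := by
    push_cast; ring
  rw [symbol, this, norm_mul, Complex.norm_exp_ofReal_mul_I]
  simp

lemma sqrt_min_card_le (j j₁ j₂ : ℕ) :
    √(min (freqs j).card (min (freqs j₁).card (freqs j₂).card) : ℕ) ≤
      2 * √(2 ^ (min j (min j₁ j₂))) := by
  have h : min (freqs j).card (min (freqs j₁).card (freqs j₂).card) ≤
      2 ^ (min j (min j₁ j₂) + 2) := by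
    rcases min_choice j (min j₁ j₂) with h | h
    · rw [h]; exact (min_le_left _ _).trans (card_freqs_le j)
    · rw [h]
      rcases min_choice j₁ j₂ with h' | h'
      · rw [h']
        exact ((min_le_right _ _).trans (min_le_left _ _)).trans (card_freqs_le j₁)
      · rw [h']
        exact ((min_le_right _ _).trans (min_le_right _ _)).trans (card_freqs_le j₂)
  calc √(min (freqs j).card (min (freqs j₁).card (freqs j₂).card) : ℕ)
      ≤ √(2 ^ (min j (min j₁ j₂)) * 2 ^ 2) := by
        refine Real.sqrt_le_sqrt ?_
        rw [← pow_add]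
        exact_mod_cast h
    _ = _ := by
        rw [Real.sqrt_mul (by positivity), Real.sqrt_sq (by norm_num), mul_comm]

lemma norm_interaction_le (j j₁ j₂ : ℕ) (τ : ℝ) (x y : L2T) :
    ‖interaction j j₁ j₂ τ x y‖ ≤ (4 * 2 ^ j * √(2 ^ (min j (min j₁ j₂)))) * ‖x‖ * ‖y‖ := by
  have h := norm_bilinMult_le (S := freqs j) (S₁ := freqs j₁) (S₂ := freqs j₂) (m := symbol τ)
    (D := 2 ^ (j + 1)) (fun k hk p _ _ => by rw [norm_symbol]; exact abs_le_of_mem_freqs hk)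
    (by positivity) x y
  refine h.trans (mul_le_mul_of_nonneg_right (mul_le_mul_of_nonneg_right ?_ (norm_nonneg x))
    (norm_nonneg y))
  calc _ ≤ (2 : ℝ) ^ (j + 1) * (2 * √(2 ^ (min j (min j₁ j₂)))) :=
        mul_le_mul_of_nonneg_left (sqrt_min_card_le j j₁ j₂) (by positivity)
    _ = _ := by rw [pow_succ]; ring

lemma integral_interaction (j j₁ j₂ : ℕ) (x y : L2T) (c d : ℝ) :
    ∫ τ in Ico c d, interaction j j₁ j₂ τ x y =
      bilinMult (freqs j) (freqs j₁) (freqs j₂) (fun k p => ∫ τ in Ico c d, symbol τ k p) x y := by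
  have hi : ∀ k p, IntegrableOn (fun τ => symbol τ k p) (Ico c d) := fun k p =>
    ((continuous_symbol k p).integrableOn_Icc).mono_set Ico_subset_Icc_self
  simp only [interaction, bilinMult_apply]
  rw [integral_finsetSum _ fun k _ =>
    (integrable_finsetSum _ fun p _ => (hi k p).mul_const _).smul_const _]
  refine Finset.sum_congr rfl fun k _ => ?_
  rw [integral_smul_const, integral_finsetSum _ fun p _ => (hi k p).mul_const _]
  congr 1
  exact Finset.sum_congr rfl fun p _ => integral_mul_const _ _

/-- No block may be the zeroth, because frequency `0` lies there and makes the resonance vanish. -/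
lemma norm_integral_interaction_le {j j₁ j₂ : ℕ} (hj : j ≠ 0) (hj₁ : j₁ ≠ 0) (hj₂ : j₂ ≠ 0)
    (x y : L2T) {c d : ℝ} (hcd : c ≤ d) :
    ‖∫ τ in Ico c d, interaction j j₁ j₂ τ x y‖ ≤
      (8 * 2 ^ j / √(2 ^ (max j (max j₁ j₂)))) * √(d - c) * ‖x‖ * ‖y‖ := by
  set l := min j (min j₁ j₂) with hl
  set M := max j (max j₁ j₂) with hM
  have hdc : 0 ≤ d - c := sub_nonneg.2 hcd
  have h2 : (0 : ℝ) < 2 ^ l * 2 ^ M := by positivity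
  rw [integral_interaction]
  have hm : ∀ k ∈ freqs j, ∀ p ∈ freqs j₁, k - p ∈ freqs j₂ →
      ‖∫ τ in Ico c d, symbol τ k p‖ ≤ 2 ^ (j + 1) * √(2 * (d - c) / (2 ^ l * 2 ^ M)) := by
    intro k hk p hp hq
    have hk' := le_abs_of_mem_freqs hj hk
    have hp' := le_abs_of_mem_freqs hj₁ hp
    have hq' := le_abs_of_mem_freqs hj₂ hq
    have hpow : ∀ {a b : ℕ}, a ≤ b → (2 : ℝ) ^ a ≤ 2 ^ b := fun h =>
      pow_le_pow_right₀ one_le_two h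
    have hres : (2 : ℝ) ^ l * 2 ^ M ≤ |resonance k p| := by
      refine mul_le_abs_resonance (by positivity) ?_ ?_ ?_ ?_
      · exact (hpow (by simp [hl])).trans hk'
      · exact (hpow (by simp [hl])).trans hp'
      · exact (hpow (by simp [hl])).trans hq'
      · rcases max_choice j (max j₁ j₂) with h | h
        · right; right; rw [hM, h]; exact hk'
        · rcases max_choice j₁ j₂ with h' | h'
          · left; rw [hM, h, h']; exact hp'
          · right; left; rw [hM, h, h']; exact hq'
    have hne : resonance k p ≠ 0 := abs_pos.1 (h2.trans_le hres)
    simp only [symbol]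
    rw [integral_const_mul, norm_mul]
    have hIk : ‖Complex.I * (k : ℂ)‖ = |(k : ℝ)| := by simp
    rw [hIk]
    gcongr
    · exact abs_le_of_mem_freqs hk
    · refine (norm_integral_exp_le hne hcd).trans (Real.sqrt_le_sqrt ?_)
      gcongr
  have h := norm_bilinMult_le hm (by positivity) x y
  refine h.trans (mul_le_mul_of_nonneg_right (mul_le_mul_of_nonneg_right ?_ (norm_nonneg x))
    (norm_nonneg y))
  -- The gain `2^{-l/2}` from the resonance cancels the loss `2^{l/2}` from the size of the smallest
  -- block.
  calc _ ≤ (2 : ℝ) ^ (j + 1) * √(2 * (d - c) / (2 ^ l * 2 ^ M)) * (2 * √(2 ^ l)) :=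
        mul_le_mul_of_nonneg_left (sqrt_min_card_le j j₁ j₂) (by positivity)
    _ = 4 * √2 * 2 ^ j / √(2 ^ M) * √(d - c) := by
        rw [Real.sqrt_div (by positivity), Real.sqrt_mul (by positivity),
          Real.sqrt_mul (by positivity), pow_succ]
        have : √((2 : ℝ) ^ l) ≠ 0 := by positivity
        have : √((2 : ℝ) ^ M) ≠ 0 := by positivity
        field_simp
        ring
    _ ≤ _ := by
        gcongr
        have : √2 ≤ 2 := by
          rw [Real.sqrt_le_left (by norm_num)]; norm_num
        linarith

end Interaction

/-! ### Decomposition of the product into dyadic blocks -/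

section Decomposition

/-- The profile of the dyadic block of `u`. -/
noncomputable def profile (j : ℕ) (u : ℝ → L2T) (t : ℝ) : L2T :=
  flow (-t) (dyadicProj j (fourierCoeff (u t)))

lemma coeff_dyadicProj (j : ℕ) (c : ℤ → ℂ) (k : ℤ) :
    coeff k (dyadicProj j c) = if k ∈ freqs j then c k else 0 := by
  have h := orthonormal_iff_ite.1 (orthonormal_fourier (T := 2 * Real.pi))
  simp only [dyadicProj, map_sum, map_smul, coeff, innerSL_apply_apply, h, smul_eq_mul, mul_ite,
    mul_one, mul_zero, Finset.sum_ite_eq]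

lemma coeff_flow (t : ℝ) (f : L2T) (k : ℤ) :
    coeff k (flow t f) = Complex.exp (Complex.I * t * phase k) * coeff k f := by
  rw [coeff_eq_repr, coeff_eq_repr, flow, LinearIsometryEquiv.apply_symm_apply]

lemma ext_coeff {x y : L2T} (h : ∀ k, coeff k x = coeff k y) : x = y := by
  refine fourierBasis.repr.injective (lp.ext (funext fun k => ?_))
  rw [← coeff_eq_repr, ← coeff_eq_repr, h]

lemma flow_dyadicProj (t : ℝ) (j : ℕ) (c : ℤ → ℂ) :
    flow t (dyadicProj j c) =
      dyadicProj j fun k => Complex.exp (Complex.I * t * phase k) * c k := by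
  refine ext_coeff fun k => ?_
  rw [coeff_flow, coeff_dyadicProj, coeff_dyadicProj]
  split_ifs <;> simp

lemma coeff_profile {j : ℕ} {k : ℤ} (hk : k ∈ freqs j) (u : ℝ → L2T) (t : ℝ) :
    coeff k (profile j u t) =
      Complex.exp (-(Complex.I * t * phase k)) * fourierCoeff (u t) k := by
  rw [profile, coeff_flow, coeff_dyadicProj, if_pos hk]
  congr 2
  push_cast; ring

/-- The Fourier coefficients of a product of two `L²` functions are given by convolution. -/
lemma hasSum_fourierCoeff_mul (f g : L2T) (k : ℤ) :
    HasSum (fun p => fourierCoeff f p * fourierCoeff g (k - p))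
      (fourierCoeff (fun x : Circ => f x * g x) k) := by
  have hmem : MemLp (fun x : Circ => (starRingEnd ℂ) (g x) * fourier k x) 2
      (AddCircle.haarAddCircle (T := 2 * Real.pi)) := by
    refine MemLp.of_le (Lp.memLp g) ?_ ?_
    · refine AEStronglyMeasurable.mul ?_ (fourier k).continuous.aestronglyMeasurable
      exact Complex.continuous_conj.comp_aestronglyMeasurable (Lp.memLp g).1
    · refine Eventually.of_forall fun x => ?_
      simp [fourier_apply, Circle.norm_coe]
  set h : L2T := hmem.toLp _ with hh
  have hae := hmem.coeFn_toLp
  -- Parseval for `f` and `h = conj g · e_k`: the pairing `⟨h, f⟩` is the `k`-th coefficient of `f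
  -- g`, and `⟨h, e_p⟩` is the coefficient of `g` at `k - p`.
  have key := fourierBasis.hasSum_inner_mul_inner h f
  have h1 : inner ℂ h f = fourierCoeff (fun x : Circ => f x * g x) k := by
    rw [L2.inner_def, fourierCoeff]
    refine integral_congr_ae ?_
    filter_upwards [hae] with x hx
    rw [hh, hx]
    simp only [RCLike.inner_apply, map_mul, Complex.conj_conj, smul_eq_mul, fourier_neg]
    ring
  have h2 : ∀ p, inner ℂ h (fourierBasis p : L2T) = fourierCoeff g (k - p) := by
    intro p
    rw [coe_fourierBasis, L2.inner_def, fourierCoeff]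
    refine integral_congr_ae ?_
    filter_upwards [hae, coeFn_fourierLp (T := 2 * Real.pi) 2 p] with x hx hp
    rw [hh, hx, hp]
    simp only [RCLike.inner_apply, map_mul, Complex.conj_conj, smul_eq_mul, neg_sub]
    rw [sub_eq_add_neg, fourier_add, fourier_neg]
    ring
  have h3 : ∀ p, inner ℂ (fourierBasis p : L2T) f = fourierCoeff f p := fun p => by
    rw [← fourierBasis.repr_apply_apply, fourierBasis_repr]
  rw [h1] at key
  simp_rw [h2, h3] at key
  simpa [mul_comm] using key

/-- The convolution sum over `p` is grouped by the dyadic sizes of `p` and `k - p`; the three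
propagator phases combine into the resonance. -/
lemma hasSum_interaction (j : ℕ) (u v : ℝ → L2T) (t : ℝ) :
    HasSum (fun q : ℕ × ℕ => interaction j q.1 q.2 t (profile q.1 u t) (profile q.2 v t))
      (flow (-t) (dyadicProj j (dxMul u v t))) := by
  rw [flow_dyadicProj, dyadicProj]
  simp only [interaction, bilinMult_apply]
  refine hasSum_sum fun k _ => HasSum.smul_const ?_ _
  have h := ((hasSum_fourierCoeff_mul (u t) (v t) k).tsum_fiberwise
    (fun p => (Nat.log 2 p.natAbs, Nat.log 2 (k - p).natAbs))).mul_left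
    (Complex.exp (Complex.I * ((-t : ℝ) : ℂ) * phase k) * (Complex.I * k))
  have e : Complex.exp (Complex.I * ((-t : ℝ) : ℂ) * phase k) * dxMul u v t k =
      Complex.exp (Complex.I * ((-t : ℝ) : ℂ) * phase k) * (Complex.I * k) *
        fourierCoeff (fun x : Circ => u t x * v t x) k := by
    rw [dxMul]; ring
  rw [e]
  refine h.congr_fun fun q => ?_
  have hset : (fun p : ℤ => (Nat.log 2 p.natAbs, Nat.log 2 (k - p).natAbs)) ⁻¹' {q} =
      ((freqs q.1).filter (fun p => k - p ∈ freqs q.2) : Finset ℤ) := by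
    ext p
    simp [mem_freqs, Prod.ext_iff]
  rw [hset, Finset.tsum_subtype' _ fun p => fourierCoeff (u t) p * fourierCoeff (v t) (k - p),
    Finset.mul_sum]
  refine Finset.sum_congr rfl fun p hp => ?_
  rw [Finset.mem_filter] at hp
  rw [coeff_profile hp.1, coeff_profile hp.2, symbol]
  have hexp : Complex.exp (-(Complex.I * t * resonance k p)) *
      (Complex.exp (-(Complex.I * t * phase p)) * Complex.exp (-(Complex.I * t * phase (k - p)))) =
      Complex.exp (Complex.I * ((-t : ℝ) : ℂ) * phase k) := by
    rw [← Complex.exp_add, ← Complex.exp_add, resonance]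
    congr 1
    push_cast; ring
  rw [← hexp]
  ring

end Decomposition
-- Estimates for one pair of blocks on an interval
section Block

variable {T : ℝ} {j j₁ j₂ : ℕ} {u v : ℝ → L2T}

lemma window_pos (hT : 0 < T) (j : ℕ) : 0 < window T j := lt_min (by positivity) hT

lemma window_le (T : ℝ) (j : ℕ) : window T j ≤ T := min_le_right _ _

/-- The supremum of the `U²`-norms of the dyadic block of `u` over the admissible intervals. -/
noncomputable def blockNorm (T : ℝ) (j : ℕ) (u : ℝ → L2T) : ℝ≥0∞ :=
  ⨆ (a : ℝ) (_ : 0 ≤ a) (_ : a + window T j ≤ T), U2norm a (a + window T j) (profile j u)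

lemma U2norm_le_blockNorm {a : ℝ} (h0 : 0 ≤ a) (hT : a + window T j ≤ T) :
    U2norm a (a + window T j) (profile j u) ≤ blockNorm T j u :=
  le_iSup_of_le a <| le_iSup_of_le h0 <| le_iSup_of_le hT le_rfl

lemma exists_window {c d : ℝ} (hc : 0 ≤ c) (hd : d ≤ T) (hcd : d - c ≤ window T j) :
    ∃ a, 0 ≤ a ∧ a + window T j ≤ T ∧ Ico c d ⊆ Ico a (a + window T j) := by
  rcases le_total c (T - window T j) with h | h
  · exact ⟨c, hc, by linarith, Ico_subset_Ico le_rfl (by linarith)⟩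
  · exact ⟨T - window T j, sub_nonneg.2 (window_le T j), by linarith,
      Ico_subset_Ico h (by linarith)⟩

lemma exists_window_mem (hT : 0 < T) {t : ℝ} (ht : t ∈ Ico 0 T) :
    ∃ a, 0 ≤ a ∧ a + window T j ≤ T ∧ t ∈ Ico a (a + window T j) := by
  have hw := window_pos hT j
  obtain ⟨a, h0, h1, h2⟩ := exists_window (T := T) (j := j) (c := t) (d := min T (t + window T j))
    ht.1 (min_le_left _ _) (by linarith [min_le_right T (t + window T j)])
  exact ⟨a, h0, h1, h2 ⟨le_rfl, lt_min ht.2 (by linarith)⟩⟩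

lemma enorm_profile_le (hT : 0 < T) {t : ℝ} (ht : t ∈ Ico 0 T) :
    ‖profile j u t‖ₑ ≤ blockNorm T j u := by
  obtain ⟨a, h0, h1, h2⟩ := exists_window_mem (j := j) hT ht
  exact (enorm_le_U2norm _ h2).trans (U2norm_le_blockNorm h0 h1)

lemma aestronglyMeasurable_profile (hT : 0 < T) (h : blockNorm T j u ≠ ∞) :
    AEStronglyMeasurable (profile j u) (volume.restrict (Ico 0 T)) := by
  have hw := window_pos hT j
  -- Consecutive windows cover `[0, T)`; the minimum pushes the last ones back so that they stay
  -- inside `[0, T]`.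
  set s : ℕ → ℝ := fun i => min (i * window T j) (T - window T j) with hs
  have hcover : Ico 0 T ⊆ ⋃ i, Ico (s i) (s i + window T j) := by
    intro t ht
    have h0 : 0 ≤ t / window T j := div_nonneg ht.1 hw.le
    have h1 : ⌊t / window T j⌋₊ * window T j ≤ t := by
      have := mul_le_mul_of_nonneg_right (Nat.floor_le h0) hw.le
      rwa [div_mul_cancel₀ _ hw.ne'] at this
    have h2 : t < (⌊t / window T j⌋₊ + 1) * window T j := by
      have := mul_lt_mul_of_pos_right (Nat.lt_floor_add_one (t / window T j)) hw
      rwa [div_mul_cancel₀ _ hw.ne'] at this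
    refine mem_iUnion.2 ⟨⌊t / window T j⌋₊, (min_le_left _ _).trans h1, ?_⟩
    simp only [hs]
    rcases min_choice (⌊t / window T j⌋₊ * window T j) (T - window T j) with e | e <;> rw [e]
    · linarith
    · linarith [ht.2]
  refine AEStronglyMeasurable.mono_set hcover ?_
  rw [aestronglyMeasurable_iUnion_iff]
  intro i
  refine aestronglyMeasurable_of_U2norm (ne_top_of_le_ne_top h (U2norm_le_blockNorm ?_ ?_))
  · exact le_min (by positivity) (sub_nonneg.2 (window_le T j))
  · have := min_le_right (i * window T j) (T - window T j)
    simp only [hs]; linarith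

/-- The contribution of two dyadic blocks to the nonlinearity. -/
noncomputable def blockTerm (j j₁ j₂ : ℕ) (u v : ℝ → L2T) (t : ℝ) : L2T :=
  interaction j j₁ j₂ t (profile j₁ u t) (profile j₂ v t)

lemma enorm_blockTerm_le (hT : 0 < T) {t : ℝ} (ht : t ∈ Ico 0 T) :
    ‖blockTerm j j₁ j₂ u v t‖ₑ ≤
      ENNReal.ofReal (4 * 2 ^ j * √(2 ^ (min j (min j₁ j₂)))) *
        (blockNorm T j₁ u * blockNorm T j₂ v) := by
  have h := norm_interaction_le j j₁ j₂ t (profile j₁ u t) (profile j₂ v t)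
  calc ‖blockTerm j j₁ j₂ u v t‖ₑ ≤ ENNReal.ofReal
        ((4 * 2 ^ j * √(2 ^ (min j (min j₁ j₂)))) * (‖profile j₁ u t‖ * ‖profile j₂ v t‖)) := by
        rw [← ofReal_norm, ← mul_assoc]
        exact ENNReal.ofReal_le_ofReal h
    _ = ENNReal.ofReal (4 * 2 ^ j * √(2 ^ (min j (min j₁ j₂)))) *
          (‖profile j₁ u t‖ₑ * ‖profile j₂ v t‖ₑ) := by
        rw [ENNReal.ofReal_mul (by positivity), ENNReal.ofReal_mul (norm_nonneg _), ofReal_norm,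
          ofReal_norm]
    _ ≤ _ := by
        gcongr
        · exact enorm_profile_le hT ht
        · exact enorm_profile_le hT ht

/-- Covers the product `0 · ∞`, where the other profile need not be measurable. -/
lemma blockTerm_eq_zero (hT : 0 < T) (h : blockNorm T j₁ u * blockNorm T j₂ v = 0) {t : ℝ}
    (ht : t ∈ Ico 0 T) : blockTerm j j₁ j₂ u v t = 0 := by
  have := enorm_blockTerm_le (j := j) hT ht (u := u) (v := v) (j₁ := j₁) (j₂ := j₂)
  rw [h, mul_zero] at this
  simpa using this

lemma aestronglyMeasurable_blockTerm (hT : 0 < T)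
    (h : blockNorm T j₁ u * blockNorm T j₂ v ≠ ∞) :
    AEStronglyMeasurable (blockTerm j j₁ j₂ u v) (volume.restrict (Ico 0 T)) := by
  by_cases h0 : blockNorm T j₁ u * blockNorm T j₂ v = 0
  · refine (aestronglyMeasurable_zero (β := L2T)).congr ?_
    filter_upwards [ae_restrict_mem measurableSet_Ico] with t ht
    exact (blockTerm_eq_zero hT h0 ht).symm
  · obtain ⟨hA, hB⟩ := mul_ne_zero_iff.1 h0
    have hA' : blockNorm T j₁ u ≠ ∞ := fun e => h (by rw [e, ENNReal.top_mul hB])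
    have hB' : blockNorm T j₂ v ≠ ∞ := fun e => h (by rw [e, ENNReal.mul_top hA])
    exact aestronglyMeasurable_bilinear (continuous_interaction j j₁ j₂)
      (aestronglyMeasurable_profile hT hA') (aestronglyMeasurable_profile hT hB')

lemma enorm_integral_blockTerm_le (hT : 0 < T) {c d : ℝ} (hc : 0 ≤ c) (hd : d ≤ T) :
    ‖∫ t in Ico c d, blockTerm j j₁ j₂ u v t‖ₑ ≤
      ENNReal.ofReal (4 * 2 ^ j * √(2 ^ (min j (min j₁ j₂))) * (d - c)) *
        (blockNorm T j₁ u * blockNorm T j₂ v) := by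
  calc _ ≤ ∫⁻ t in Ico c d, ‖blockTerm j j₁ j₂ u v t‖ₑ := enorm_integral_le_lintegral_enorm _
    _ ≤ ∫⁻ _ in Ico c d, ENNReal.ofReal (4 * 2 ^ j * √(2 ^ (min j (min j₁ j₂)))) *
        (blockNorm T j₁ u * blockNorm T j₂ v) := by
        refine setLIntegral_mono measurable_const fun t ht => ?_
        exact enorm_blockTerm_le hT ⟨hc.trans ht.1, ht.2.trans_le hd⟩
    _ = _ := by
        rw [setLIntegral_const, Real.volume_Ico,
          ENNReal.ofReal_mul (p := 4 * 2 ^ j * √(2 ^ (min j (min j₁ j₂)))) (by positivity)]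
        ring

/-- The gain from the time oscillations, on the time scale of the highest frequency. -/
lemma enorm_integral_blockTerm_le_of_short (hT : 0 < T) (hj : j ≠ 0) (hj₁ : j₁ ≠ 0) (hj₂ : j₂ ≠ 0)
    (h : blockNorm T j₁ u * blockNorm T j₂ v ≠ ∞)
    {c d : ℝ} (hc : 0 ≤ c) (hcd : c ≤ d) (hd : d ≤ T)
    (h₁ : d - c ≤ window T j₁) (h₂ : d - c ≤ window T j₂) :
    ‖∫ t in Ico c d, blockTerm j j₁ j₂ u v t‖ₑ ≤
      ENNReal.ofReal (8 * 2 ^ j / √(2 ^ (max j (max j₁ j₂))) * √(d - c)) *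
        (blockNorm T j₁ u * blockNorm T j₂ v) := by
  by_cases h0 : blockNorm T j₁ u * blockNorm T j₂ v = 0
  · rw [setIntegral_congr_fun (g := fun _ => (0 : L2T)) measurableSet_Ico
      (fun t ht => blockTerm_eq_zero hT h0 ⟨hc.trans ht.1, ht.2.trans_le hd⟩)]
    simp
  · obtain ⟨hA, hB⟩ := mul_ne_zero_iff.1 h0
    have hA' : blockNorm T j₁ u ≠ ∞ := fun e => h (by rw [e, ENNReal.top_mul hB])
    have hB' : blockNorm T j₂ v ≠ ∞ := fun e => h (by rw [e, ENNReal.mul_top hA])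
    obtain ⟨a₁, ha₁, hb₁, hs₁⟩ := exists_window hc hd h₁
    obtain ⟨a₂, ha₂, hb₂, hs₂⟩ := exists_window hc hd h₂
    have l₁ := U2norm_le_blockNorm (u := u) ha₁ hb₁
    have l₂ := U2norm_le_blockNorm (u := v) ha₂ hb₂
    set L : ℝ≥0 := ⟨8 * 2 ^ j / √(2 ^ (max j (max j₁ j₂))), by positivity⟩ with hL
    have key := enorm_integral_bilinear_le (continuous_interaction j j₁ j₂) (L := L)
      (D := 4 * 2 ^ j * √(2 ^ (min j (min j₁ j₂)))) (by positivity) (norm_interaction_le j j₁ j₂)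
      (fun x y c d hcd => norm_integral_interaction_le hj hj₁ hj₂ x y hcd) hcd hs₁ hs₂
      (ne_top_of_le_ne_top hA' l₁) (ne_top_of_le_ne_top hB' l₂)
    refine key.trans ?_
    rw [mul_assoc]
    exact mul_le_mul' le_rfl (mul_le_mul' l₁ l₂)

end Block
-- Bounds over grid intervals and their sum over levels
section GridBounds

variable {T : ℝ} {j j₁ j₂ : ℕ} {u v : ℝ → L2T}

/-- The bound for the integrals of a block over dyadic intervals of level `n`. -/
noncomputable def levelBound (j j₁ j₂ n : ℕ) : ℝ :=
  if n < max j (max j₁ j₂) - j then 8 / 2 ^ n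
  else if n < max j (max j₁ j₂) - j + min j (min j₁ j₂) then 8 / √(2 ^ n)
  else 4 * √(2 ^ (min j (min j₁ j₂))) / 2 ^ n

lemma integrableOn_blockTerm (hT : 0 < T) (h : blockNorm T j₁ u * blockNorm T j₂ v ≠ ∞) :
    IntegrableOn (blockTerm j j₁ j₂ u v) (Ico 0 T) := by
  refine ⟨aestronglyMeasurable_blockTerm hT h, ?_⟩
  rw [hasFiniteIntegral_iff_enorm]
  refine lt_of_le_of_lt (setLIntegral_mono measurable_const fun t ht => enorm_blockTerm_le hT ht) ?_
  rw [setLIntegral_const]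
  exact ENNReal.mul_lt_top (ENNReal.mul_lt_top ENNReal.ofReal_lt_top h.lt_top) (by simp)

/-- No oscillation is used: the factor `2^j` of the pointwise bound cancels the window length, at
most `2^{-j}`. -/
lemma enorm_integral_grid_le_of_fine (hT : 0 < T) {a : ℝ} (ha : 0 ≤ a) (hb : a + window T j ≤ T)
    {n i : ℕ} (hi : i < 2 ^ n) :
    ‖∫ t in Ico (grid a (a + window T j) n i) (grid a (a + window T j) n (i + 1)),
        blockTerm j j₁ j₂ u v t‖ₑ ≤
      ENNReal.ofReal (4 * √(2 ^ (min j (min j₁ j₂))) / 2 ^ n) *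
        (blockNorm T j₁ u * blockNorm T j₂ v) := by
  have hab : a < a + window T j := by linarith [window_pos hT j]
  have h1 := grid_mem_Icc hab hi.le
  have h2 := grid_mem_Icc hab (Nat.succ_le_of_lt hi)
  have hw : window T j ≤ (2 ^ j)⁻¹ := min_le_left _ _
  refine (enorm_integral_blockTerm_le hT (ha.trans h1.1) (h2.2.trans hb)).trans ?_
  gcongr
  rw [grid_succ_sub, add_sub_cancel_left]
  calc 4 * 2 ^ j * √(2 ^ (min j (min j₁ j₂))) * (window T j / 2 ^ n)
      ≤ 4 * 2 ^ j * √(2 ^ (min j (min j₁ j₂))) * ((2 ^ j)⁻¹ / 2 ^ n) := by gcongr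
    _ = _ := by field_simp

lemma enorm_integral_grid_le_of_medium (hT : 0 < T) (hj : j ≠ 0) (hj₁ : j₁ ≠ 0) (hj₂ : j₂ ≠ 0)
    (h : blockNorm T j₁ u * blockNorm T j₂ v ≠ ∞) {a : ℝ} (ha : 0 ≤ a)
    (hb : a + window T j ≤ T) {n i : ℕ} (hi : i < 2 ^ n) (hn : max j (max j₁ j₂) - j ≤ n) :
    ‖∫ t in Ico (grid a (a + window T j) n i) (grid a (a + window T j) n (i + 1)),
        blockTerm j j₁ j₂ u v t‖ₑ ≤
      ENNReal.ofReal (8 / (√(2 ^ (max j (max j₁ j₂) - j)) * √(2 ^ n))) *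
        (blockNorm T j₁ u * blockNorm T j₂ v) := by
  have hab : a < a + window T j := by linarith [window_pos hT j]
  have h1 := grid_mem_Icc hab hi.le
  have h2 := grid_mem_Icc hab (Nat.succ_le_of_lt hi)
  set M := max j (max j₁ j₂) with hM
  have hjM : j ≤ M := le_max_left _ _
  have hw : window T j ≤ (2 ^ j)⁻¹ := min_le_left _ _
  have hpos := window_pos hT j
  have hlen : grid a (a + window T j) n (i + 1) - grid a (a + window T j) n i =
      window T j / 2 ^ n := by rw [grid_succ_sub, add_sub_cancel_left]
  -- From level `M - j` on, a grid interval has length at most `2^{-M}`, so it fits into a window of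
  -- either input.
  have hshort : ∀ l, l ≤ M → window T j / 2 ^ n ≤ window T l := by
    intro l hl
    refine le_min ?_ ?_
    · calc window T j / 2 ^ n ≤ (2 ^ j)⁻¹ / 2 ^ n := by gcongr
        _ = (2 ^ (j + n))⁻¹ := by rw [pow_add]; field_simp
        _ ≤ (2 ^ l)⁻¹ := by
          gcongr
          · norm_num
          · omega
    · exact (div_le_self hpos.le (one_le_pow₀ one_le_two)).trans (window_le T j)
  refine (enorm_integral_blockTerm_le_of_short hT hj hj₁ hj₂ h (ha.trans h1.1)
    ((grid_strictMono hab n).monotone (Nat.le_succ i)) (h2.2.trans hb) ?_ ?_).trans ?_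
  · rw [hlen]; exact hshort _ (by simp [hM])
  · rw [hlen]; exact hshort _ (by simp [hM])
  · rw [hlen]
    gcongr
    calc 8 * 2 ^ j / √(2 ^ M) * √(window T j / 2 ^ n)
        ≤ 8 * 2 ^ j / √(2 ^ M) * √((2 ^ j)⁻¹ / 2 ^ n) := by gcongr
      _ = 8 / (√(2 ^ (M - j)) * √(2 ^ n)) := by
        have e : (2 : ℝ) ^ M = 2 ^ j * 2 ^ (M - j) := by rw [← pow_add]; congr 1; omega
        rw [e, Real.sqrt_mul (by positivity), Real.sqrt_div (by positivity), Real.sqrt_inv]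
        have h3 : √((2 : ℝ) ^ j) * √(2 ^ j) = 2 ^ j := Real.mul_self_sqrt (by positivity)
        have : √((2 : ℝ) ^ j) ≠ 0 := by positivity
        have : √((2 : ℝ) ^ n) ≠ 0 := by positivity
        have : √((2 : ℝ) ^ (M - j)) ≠ 0 := by positivity
        field_simp
        rw [sq, h3]

/-- Descending induction from the level `M - j`, where the medium bound is exactly `8 / 2 ^ n`.
Halving an interval and adding the two bounds reproduces the same form one level up. -/
lemma enorm_integral_grid_le_of_coarse (hT : 0 < T) (hj : j ≠ 0) (hj₁ : j₁ ≠ 0) (hj₂ : j₂ ≠ 0)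
    (h : blockNorm T j₁ u * blockNorm T j₂ v ≠ ∞) {a : ℝ} (ha : 0 ≤ a)
    (hb : a + window T j ≤ T) (r : ℕ) :
    ∀ n i : ℕ, i < 2 ^ n → n + r = max j (max j₁ j₂) - j →
    ‖∫ t in Ico (grid a (a + window T j) n i) (grid a (a + window T j) n (i + 1)),
        blockTerm j j₁ j₂ u v t‖ₑ ≤
      ENNReal.ofReal (8 / 2 ^ n) * (blockNorm T j₁ u * blockNorm T j₂ v) := by
  have hab : a < a + window T j := by linarith [window_pos hT j]
  induction r with
  | zero =>
    intro n i hi hn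
    rw [add_zero] at hn
    refine (enorm_integral_grid_le_of_medium hT hj hj₁ hj₂ h ha hb hi hn.ge).trans ?_
    rw [← hn, Real.mul_self_sqrt (by positivity)]
  | succ r ih =>
    intro n i hi hn
    have hlt : 2 * i + 1 < 2 ^ (n + 1) := by
      have := pow_succ 2 n; omega
    have e0 : grid a (a + window T j) n i = grid a (a + window T j) (n + 1) (2 * i) :=
      (grid_succ_level _ _ _ _).symm
    have e1 : grid a (a + window T j) n (i + 1) = grid a (a + window T j) (n + 1) (2 * i + 1 + 1) := by
      rw [← grid_succ_level]; ring_nf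
    have m0 := (grid_strictMono hab (n + 1)).monotone (Nat.le_succ (2 * i))
    have m1 := (grid_strictMono hab (n + 1)).monotone (Nat.le_succ (2 * i + 1))
    have b0 := grid_mem_Icc (n := n + 1) (i := 2 * i) hab (by omega)
    have b1 := grid_mem_Icc (n := n + 1) (i := 2 * i + 1 + 1) hab (by omega)
    simp only [Nat.succ_eq_add_one] at m0 m1
    have hint : ∀ {x y}, a ≤ x → y ≤ a + window T j →
        IntegrableOn (blockTerm j j₁ j₂ u v) (Ico x y) := fun hx hy =>
      (integrableOn_blockTerm hT h).mono_set (Ico_subset_Ico (ha.trans hx) (hy.trans hb))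
    rw [e0, e1, ← Ico_union_Ico_eq_Ico m0 m1, setIntegral_union
      (by rw [Ico_disjoint_Ico]; simp [m0, m1]) measurableSet_Ico
      (hint b0.1 (m1.trans b1.2)) (hint (b0.1.trans m0) b1.2)]
    refine (enorm_add_le _ _).trans ?_
    refine (add_le_add (ih (n + 1) (2 * i) (by omega) (by omega))
      (ih (n + 1) (2 * i + 1) hlt (by omega))).trans (le_of_eq ?_)
    rw [← add_mul, ← ENNReal.ofReal_add (by positivity) (by positivity)]
    congr 2
    rw [pow_succ]; field_simp; norm_num

lemma enorm_integral_grid_le (hT : 0 < T) (h : blockNorm T j₁ u * blockNorm T j₂ v ≠ ∞)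
    {a : ℝ} (ha : 0 ≤ a) (hb : a + window T j ≤ T) {n i : ℕ} (hi : i < 2 ^ n) :
    ‖∫ t in Ico (grid a (a + window T j) n i) (grid a (a + window T j) n (i + 1)),
        blockTerm j j₁ j₂ u v t‖ₑ ≤
      ENNReal.ofReal (levelBound j j₁ j₂ n) * (blockNorm T j₁ u * blockNorm T j₂ v) := by
  have hfine := enorm_integral_grid_le_of_fine (j₁ := j₁) (j₂ := j₂) (u := u) (v := v) hT ha hb hi
  -- A zeroth block may have no oscillation, but then the fine bound is `4 / 2 ^ n`, the middle
  -- range is empty, and the bound suffices at every level.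
  by_cases h0 : min j (min j₁ j₂) = 0
  · refine hfine.trans ?_
    gcongr
    simp only [levelBound, h0, add_zero, pow_zero, Real.sqrt_one]
    split_ifs
    · gcongr; norm_num
    · exact le_rfl
  · have hj : j ≠ 0 := by rintro rfl; simp at h0
    have hj₁ : j₁ ≠ 0 := by rintro rfl; simp at h0
    have hj₂ : j₂ ≠ 0 := by rintro rfl; simp at h0
    rw [levelBound]
    split_ifs with h1 h2
    · exact enorm_integral_grid_le_of_coarse hT hj hj₁ hj₂ h ha hb _ n i hi
        (Nat.add_sub_of_le h1.le)
    · refine (enorm_integral_grid_le_of_medium hT hj hj₁ hj₂ h ha hb hi (not_lt.1 h1)).trans ?_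
      gcongr
      refine le_mul_of_one_le_left (Real.sqrt_nonneg _) ?_
      rw [Real.one_le_sqrt]
      exact one_le_pow₀ one_le_two
    · exact hfine

/-- The geometric series with ratio `1/√2`. -/
noncomputable def geomConst : ℝ≥0∞ := ∑' n : ℕ, ENNReal.ofReal (√2)⁻¹ ^ n

lemma geomConst_ne_top : geomConst ≠ ∞ := by
  rw [geomConst, ENNReal.tsum_geometric]
  have : ENNReal.ofReal (√2)⁻¹ < 1 := by
    rw [ENNReal.ofReal_lt_one]
    exact inv_lt_one_of_one_lt₀ (by rw [Real.lt_sqrt] <;> norm_num)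
  exact ENNReal.inv_ne_top.2 (tsub_pos_of_lt this).ne'

lemma one_le_geomConst : 1 ≤ geomConst := by
  simpa only [pow_zero, geomConst] using ENNReal.le_tsum (f := fun n : ℕ => ENNReal.ofReal (√2)⁻¹ ^ n) 0

lemma sqrt_two_pow (n : ℕ) : √((2 : ℝ) ^ n) = √2 ^ n := by
  rw [Real.sqrt_eq_rpow, Real.sqrt_eq_rpow, ← Real.rpow_natCast, ← Real.rpow_natCast,
    ← Real.rpow_mul (by norm_num), ← Real.rpow_mul (by norm_num), mul_comm]

/-- The three summands match the three ranges of `n`: geometric decay from `0`, a constant on a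
range of `l` levels, and geometric decay from the end of that range. Only the middle one produces
the logarithmic loss. -/
lemma sqrt_mul_levelBound_le (j j₁ j₂ n : ℕ) :
    ENNReal.ofReal √(2 ^ n) * ENNReal.ofReal (levelBound j j₁ j₂ n) ≤
      8 * (ENNReal.ofReal (√2)⁻¹ ^ n +
        (Finset.Ico (max j (max j₁ j₂) - j)
          (max j (max j₁ j₂) - j + min j (min j₁ j₂)) : Set ℕ).indicator (fun _ => 1) n +
        if max j (max j₁ j₂) - j + min j (min j₁ j₂) ≤ n then
          ENNReal.ofReal (√2)⁻¹ ^ (n - (max j (max j₁ j₂) - j + min j (min j₁ j₂))) else 0) := by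
  set m := max j (max j₁ j₂) - j
  set l := min j (min j₁ j₂)
  have hs : (0 : ℝ) < √2 := by positivity
  have h2n : (2 : ℝ) ^ n = √2 ^ n * √2 ^ n := by
    rw [← mul_pow, Real.mul_self_sqrt (by norm_num)]
  have h8 : (8 : ℝ≥0∞) = ENNReal.ofReal 8 := by simp
  rw [← ENNReal.ofReal_mul (Real.sqrt_nonneg _), sqrt_two_pow, levelBound]
  rw [← ENNReal.ofReal_pow (by positivity) n]
  split_ifs with h1 h2 h3 h3 h3
  · omega
  · calc _ = 8 * ENNReal.ofReal ((√2)⁻¹ ^ n) := by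
          rw [h8, ← ENNReal.ofReal_mul (by norm_num)]
          congr 1
          rw [h2n, inv_pow]; field_simp
      _ ≤ _ := by gcongr; rw [add_assoc]; exact le_self_add
  · omega
  · calc _ = 8 * (1 : ℝ≥0∞) := by
          rw [mul_one, h8]
          congr 1
          rw [sqrt_two_pow]; field_simp
      _ ≤ _ := by
          gcongr
          have : n ∈ (Finset.Ico m (m + l) : Set ℕ) := by simp; omega
          rw [indicator_of_mem this, add_zero]
          exact le_add_self
  · calc _ ≤ 8 * ENNReal.ofReal (√2)⁻¹ ^ (n - (m + l)) := by
          rw [h8, ← ENNReal.ofReal_pow (by positivity), ← ENNReal.ofReal_mul (by norm_num)]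
          refine ENNReal.ofReal_le_ofReal ?_
          rw [h2n, sqrt_two_pow]
          have e : √2 ^ n = √2 ^ (n - (m + l)) * √2 ^ (m + l) := by
            rw [← pow_add]; congr 1; omega
          have h1 : √2 ^ l ≤ √2 ^ (m + l) :=
            pow_le_pow_right₀ (by rw [Real.one_le_sqrt]; norm_num) (by omega)
          calc √2 ^ n * (4 * √2 ^ l / (√2 ^ n * √2 ^ n)) = 4 * (√2 ^ l / √2 ^ n) := by field_simp
            _ ≤ 8 * (√2 ^ (m + l) / √2 ^ n) := by
                gcongr; norm_num
            _ = 8 * (√2)⁻¹ ^ (n - (m + l)) := by rw [e, inv_pow]; field_simp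
      _ ≤ _ := by gcongr; exact le_add_self
  · omega

lemma tsum_levelBound_le (j j₁ j₂ : ℕ) :
    ∑' n, ENNReal.ofReal √(2 ^ n) * ENNReal.ofReal (levelBound j j₁ j₂ n) ≤
      16 * geomConst * (1 + (min j (min j₁ j₂) : ℕ)) := by
  refine (ENNReal.tsum_le_tsum (sqrt_mul_levelBound_le j j₁ j₂)).trans ?_
  rw [ENNReal.tsum_mul_left, ENNReal.tsum_add, ENNReal.tsum_add]
  set m := max j (max j₁ j₂) - j
  set l := min j (min j₁ j₂)
  have h1 : ∑' n, (Finset.Ico m (m + l) : Set ℕ).indicator (fun _ => (1 : ℝ≥0∞)) n = l := by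
    rw [tsum_eq_sum (s := Finset.Ico m (m + l))
      (fun n hn => indicator_of_notMem (by simpa using hn) _),
      Finset.sum_congr rfl (fun n hn => indicator_of_mem (by simpa using hn) _)]
    simp
  have h2 : ∑' n, (if m + l ≤ n then ENNReal.ofReal (√2)⁻¹ ^ (n - (m + l)) else 0) =
      geomConst := by
    rw [← ENNReal.summable.sum_add_tsum_nat_add' (k := m + l), Finset.sum_eq_zero, zero_add]
    · simp [geomConst]
    · intro n hn
      rw [if_neg (not_le.2 (Finset.mem_range.1 hn))]
  rw [h1, h2, ← geomConst]
  have hg := one_le_geomConst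
  calc 8 * (geomConst + (l : ℝ≥0∞) + geomConst)
      ≤ 8 * (geomConst + 2 * (geomConst * l) + geomConst) := by
        gcongr
        calc (l : ℝ≥0∞) = 1 * l := (one_mul _).symm
          _ ≤ geomConst * l := by gcongr
          _ ≤ 2 * (geomConst * l) := by
            rw [two_mul]; exact le_self_add
    _ = _ := by ring

end GridBounds
-- The `DU²`-estimate at one output frequency
section DyadicEstimate

variable {T : ℝ} {u v : ℝ → L2T}

open Classical in
/-- The weight of the interaction of dyadic blocks: logarithmic in the smallest frequency. -/
noncomputable def interactionWeight (j j₁ j₂ : ℕ) : ℝ≥0∞ :=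
  if Interacts j j₁ j₂ then 1 + (min j (min j₁ j₂) : ℕ) else 0

lemma interactionWeight_ne_zero {j j₁ j₂ : ℕ} (h : Interacts j j₁ j₂) :
    interactionWeight j j₁ j₂ ≠ 0 := by
  simp [interactionWeight, h]

lemma nontrivial_L2T : Nontrivial L2T :=
  ⟨fourierLp 2 0, 0, fun h => by
    simpa [h] using (orthonormal_fourier (T := 2 * Real.pi)).1 0⟩

lemma blockTerm_eq_zero_of_not_interacts {j j₁ j₂ : ℕ} (h : ¬ Interacts j j₁ j₂) :
    blockTerm j j₁ j₂ u v = 0 := by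
  funext t
  simp [blockTerm, interaction_eq_zero h]

/-- The `DU²`-norm of a dyadic block of the nonlinearity. -/
lemma DU2norm_dxMul_le (hT : 0 < T) (j : ℕ) {a : ℝ} (ha : 0 ≤ a) (hb : a + window T j ≤ T) :
    DU2norm a (a + window T j) (fun t => flow (-t) (dyadicProj j (dxMul u v t))) ≤
      16 * geomConst * ∑' q : ℕ × ℕ, interactionWeight j q.1 q.2 *
        (blockNorm T q.1 u * blockNorm T q.2 v) := by
  set R := ∑' q : ℕ × ℕ, interactionWeight j q.1 q.2 *
    (blockNorm T q.1 u * blockNorm T q.2 v) with hR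
  rcases eq_or_ne R ∞ with htop | htop
  · rw [htop, ENNReal.mul_top]
    · exact le_top
    · simpa using (zero_lt_one.trans_le one_le_geomConst).ne'
  have hab : a < a + window T j := by linarith [window_pos hT j]
  set b := a + window T j with hbdef
  set f : ℝ → L2T := fun t => flow (-t) (dyadicProj j (dxMul u v t)) with hf
  set h : ℕ × ℕ → ℝ → L2T := fun q => blockTerm j q.1 q.2 u v with hh
  have hsum : ∀ t, HasSum (fun q => h q t) (f t) := fun t => hasSum_interaction j u v t
  have hfin : ∀ q : ℕ × ℕ, Interacts j q.1 q.2 →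
      blockNorm T q.1 u * blockNorm T q.2 v ≠ ∞ := fun q hq e => by
    refine ENNReal.ne_top_of_tsum_ne_top htop q ?_
    rw [e, ENNReal.mul_top (interactionWeight_ne_zero hq)]
  have hmeas : ∀ q, AEStronglyMeasurable (h q) (volume.restrict (Ico 0 T)) := by
    intro q
    by_cases hq : Interacts j q.1 q.2
    · exact aestronglyMeasurable_blockTerm hT (hfin q hq)
    · simp only [hh]
      rw [blockTerm_eq_zero_of_not_interacts hq]
      exact aestronglyMeasurable_zero
  -- A crude bound, uniform in the input blocks; it serves only for integrability and for exchanging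
  -- sum and integral.
  set K : ℝ≥0∞ := ENNReal.ofReal (4 * 2 ^ j * √(2 ^ j)) with hK
  have hbound : ∀ q, ∀ t ∈ Ico 0 T, ‖h q t‖ₑ ≤ K * (interactionWeight j q.1 q.2 *
      (blockNorm T q.1 u * blockNorm T q.2 v)) := by
    intro q t ht
    by_cases hq : Interacts j q.1 q.2
    · refine (enorm_blockTerm_le hT ht).trans ?_
      refine mul_le_mul' (ENNReal.ofReal_le_ofReal ?_) ?_
      · gcongr
        · norm_num
        · exact min_le_left _ _
      · refine le_mul_of_one_le_left' ?_
        simp [interactionWeight, hq]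
    · simp only [hh]
      rw [blockTerm_eq_zero_of_not_interacts hq]
      simp
  have hfm : AEStronglyMeasurable f (volume.restrict (Ico 0 T)) := by
    refine aestronglyMeasurable_of_tendsto_ae (u := (atTop : Filter (Finset (ℕ × ℕ))))
      (f := fun s t => ∑ q ∈ s, h q t) (fun s => ?_) ?_
    · exact Finset.aestronglyMeasurable_fun_sum _ fun q _ => hmeas q
    · exact Eventually.of_forall fun t => hsum t
  have hfi : IntegrableOn f (Ico 0 T) := by
    refine ⟨hfm, ?_⟩
    rw [hasFiniteIntegral_iff_enorm]
    refine lt_of_le_of_lt (setLIntegral_mono (g := fun _ => K * R) measurable_const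
      fun t ht => ?_) ?_
    · rw [← (hsum t).tsum_eq, hR, ← ENNReal.tsum_mul_left]
      exact enorm_tsum_le_tsum_enorm.trans (ENNReal.tsum_le_tsum fun q => hbound q t ht)
    · rw [setLIntegral_const]
      exact ENNReal.mul_lt_top (ENNReal.mul_lt_top ENNReal.ofReal_lt_top htop.lt_top) (by simp)
  have hfi' : IntegrableOn f (Icc a b) := by
    rw [integrableOn_Icc_iff_integrableOn_Ico]
    exact hfi.mono_set (Ico_subset_Ico ha hb)
  have hint : ∀ c d, 0 ≤ c → d ≤ T →
      ‖∫ t in Ico c d, f t‖ₑ ≤ ∑' q, ‖∫ t in Ico c d, h q t‖ₑ := by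
    intro c d hc hd
    have hss : Ico c d ⊆ Ico 0 T := Ico_subset_Ico hc hd
    have e : ∫ t in Ico c d, f t = ∑' q, ∫ t in Ico c d, h q t := by
      rw [← integral_tsum (fun q => (hmeas q).mono_set hss)]
      · simp_rw [(hsum _).tsum_eq]
      · refine ne_top_of_le_ne_top (b := K * R * volume (Ico c d)) ?_ ?_
        · exact ENNReal.mul_ne_top (ENNReal.mul_ne_top ENNReal.ofReal_ne_top htop) (by simp)
        · rw [hR, ← ENNReal.tsum_mul_left, ← ENNReal.tsum_mul_right]
          refine ENNReal.tsum_le_tsum fun q => ?_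
          rw [← setLIntegral_const]
          exact setLIntegral_mono measurable_const fun t ht => hbound q t (hss ht)
    rw [e]
    exact enorm_tsum_le_tsum_enorm
  have := nontrivial_L2T
  classical
  set β : ℕ → ℝ≥0∞ := fun n => ∑' q : ℕ × ℕ, (if Interacts j q.1 q.2 then
    ENNReal.ofReal (levelBound j q.1 q.2 n) * (blockNorm T q.1 u * blockNorm T q.2 v) else 0)
    with hβ
  refine (DU2norm_le hab hfi' (β := β) fun n i hi => ?_).trans ?_
  · have h1 := grid_mem_Icc hab hi.le
    have h2 := grid_mem_Icc hab (Nat.succ_le_of_lt hi)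
    refine (hint _ _ (ha.trans h1.1) (h2.2.trans hb)).trans (ENNReal.tsum_le_tsum fun q => ?_)
    split_ifs with hq
    · exact enorm_integral_grid_le hT (hfin q hq) ha hb hi
    · simp only [hh]
      rw [blockTerm_eq_zero_of_not_interacts hq]
      simp
  · simp only [hβ]
    simp_rw [← ENNReal.tsum_mul_left]
    rw [ENNReal.tsum_comm, hR, ← ENNReal.tsum_mul_left]
    refine ENNReal.tsum_le_tsum fun q => ?_
    by_cases hq : Interacts j q.1 q.2
    · simp only [hq, if_true, interactionWeight]
      simp_rw [← mul_assoc]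
      rw [ENNReal.tsum_mul_right, ENNReal.tsum_mul_right]
      gcongr
      exact tsum_levelBound_le j q.1 q.2
    · simp [hq]

end DyadicEstimate
-- Summation over dyadic frequencies
section Summation

lemma ennreal_mul_le_sq_add_sq (x y : ℝ≥0∞) : x * y ≤ x ^ 2 + y ^ 2 := by
  rcases le_total x y with h | h
  · calc x * y ≤ y * y := by gcongr
      _ ≤ _ := by rw [← sq]; exact le_add_self
  · calc x * y ≤ x * x := by gcongr
      _ ≤ _ := by rw [← sq]; exact le_self_add

lemma ennreal_add_sq_le (x y : ℝ≥0∞) : (x + y) ^ 2 ≤ 4 * (x ^ 2 + y ^ 2) := by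
  rcases le_total x y with h | h
  · calc (x + y) ^ 2 ≤ (y + y) ^ 2 := by gcongr
      _ = 4 * y ^ 2 := by ring
      _ ≤ _ := by gcongr; exact le_add_self
  · calc (x + y) ^ 2 ≤ (x + x) ^ 2 := by gcongr
      _ = 4 * x ^ 2 := by ring
      _ ≤ _ := by gcongr; exact le_self_add

/-- A weighted Cauchy–Schwarz inequality. -/
lemma sq_tsum_mul_le {ι : Type*} (k a : ι → ℝ≥0∞) :
    (∑' i, k i * a i) ^ 2 ≤ 2 * (∑' i, k i) * ∑' i, k i * a i ^ 2 := by
  calc (∑' i, k i * a i) ^ 2 = ∑' i, ∑' l, (k i * a i) * (k l * a l) := by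
        rw [sq, ← ENNReal.tsum_mul_right]
        simp_rw [ENNReal.tsum_mul_left]
    -- Expanding the square and using `xy ≤ x² + y²` avoids square roots in `[0, ∞]`, at the price
    -- of the factor `2`.
    _ ≤ ∑' i, ∑' l, (k i * (k l * a l ^ 2) + (k i * a i ^ 2) * k l) := by
        refine ENNReal.tsum_le_tsum fun i => ENNReal.tsum_le_tsum fun l => ?_
        calc (k i * a i) * (k l * a l) = k i * k l * (a i * a l) := by ring
          _ ≤ k i * k l * (a i ^ 2 + a l ^ 2) := by
              gcongr; exact ennreal_mul_le_sq_add_sq _ _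
          _ = _ := by ring
    _ = _ := by
        simp_rw [ENNReal.tsum_add, ENNReal.tsum_mul_left, ENNReal.tsum_mul_right]
        ring

variable {q : ℝ≥0∞}

/-- With truncated subtraction, `(l - j) + (j - l)` is the distance `|l - j|`. -/
lemma tsum_pow_dist_le (j : ℕ) :
    ∑' l : ℕ, q ^ ((l - j) + (j - l)) ≤ 2 * ∑' n : ℕ, q ^ n := by
  rw [← ENNReal.summable.sum_add_tsum_nat_add' (k := j), two_mul]
  refine add_le_add ?_ ?_
  · rw [← Finset.sum_range_reflect]
    calc _ = ∑ i ∈ Finset.range j, q ^ (i + 1) := by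
          refine Finset.sum_congr rfl fun i hi => ?_
          rw [Finset.mem_range] at hi
          congr 1
          omega
      _ ≤ ∑' i : ℕ, q ^ (i + 1) := ENNReal.sum_le_tsum _
      _ ≤ _ := ENNReal.tsum_comp_le_tsum_of_injective (add_left_injective 1) fun n => q ^ n
  · refine ENNReal.tsum_le_tsum fun n => le_of_eq ?_
    congr 1
    omega

lemma sq_tsum_pow_mul_le (hq : q ≤ 1) (α : ℕ → ℝ≥0∞) :
    (∑' i : ℕ, q ^ i * α i) ^ 2 ≤ 2 * (∑' n : ℕ, q ^ n) * ∑' i, α i ^ 2 := by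
  refine (sq_tsum_mul_le _ _).trans ?_
  gcongr with i
  exact mul_le_of_le_one_left' (pow_le_one' hq i)

/-- Schur's test: the kernel `q^{|l-j|}` has row and column sums at most `2 ∑ qⁿ`. -/
lemma tsum_sq_tsum_pow_dist_mul_le (β : ℕ → ℝ≥0∞) :
    ∑' j : ℕ, (∑' l : ℕ, q ^ ((l - j) + (j - l)) * β l) ^ 2 ≤
      8 * (∑' n : ℕ, q ^ n) ^ 2 * ∑' l, β l ^ 2 := by
  set Q := ∑' n : ℕ, q ^ n
  calc _ ≤ ∑' j : ℕ, 4 * Q * ∑' l : ℕ, q ^ ((l - j) + (j - l)) * β l ^ 2 := by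
        refine ENNReal.tsum_le_tsum fun j =>
          (sq_tsum_mul_le _ _).trans (mul_le_mul' ?_ le_rfl)
        calc _ ≤ 2 * (2 * Q) := by gcongr; exact tsum_pow_dist_le j
          _ = _ := by ring
    _ = 4 * Q * ∑' l : ℕ, (∑' j : ℕ, q ^ ((l - j) + (j - l))) * β l ^ 2 := by
        rw [ENNReal.tsum_mul_left, ENNReal.tsum_comm]
        simp_rw [ENNReal.tsum_mul_right]
    _ ≤ 4 * Q * ∑' l : ℕ, (2 * Q) * β l ^ 2 := by
        gcongr with l
        simp_rw [add_comm (l - _)]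
        exact tsum_pow_dist_le l
    _ = _ := by rw [ENNReal.tsum_mul_left]; ring

/-- Summation of the dyadic pieces. -/
lemma tsum_sq_tsum_kernel_le (hq : q ≤ 1) (α β : ℕ → ℝ≥0∞) :
    ∑' j : ℕ, (∑' p : ℕ × ℕ, (q ^ p.1 * q ^ ((p.2 - j) + (j - p.2)) +
        q ^ p.2 * q ^ ((p.1 - j) + (j - p.1))) * (α p.1 * β p.2)) ^ 2 ≤
      128 * (∑' n : ℕ, q ^ n) ^ 3 * ((∑' i, α i ^ 2) * ∑' l, β l ^ 2) := by
  set Q := ∑' n : ℕ, q ^ n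
  -- Each half of the kernel factorizes: a scalar sum over the index with decay from `0`, times a
  -- discrete convolution in the other index.
  have hsplit : ∀ j : ℕ, ∑' p : ℕ × ℕ, (q ^ p.1 * q ^ ((p.2 - j) + (j - p.2)) +
        q ^ p.2 * q ^ ((p.1 - j) + (j - p.1))) * (α p.1 * β p.2) =
      (∑' i : ℕ, q ^ i * α i) * (∑' l : ℕ, q ^ ((l - j) + (j - l)) * β l) +
      (∑' l : ℕ, q ^ l * β l) * (∑' i : ℕ, q ^ ((i - j) + (j - i)) * α i) := by
    intro j
    rw [mul_comm (∑' l : ℕ, q ^ l * β l)]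
    rw [← ENNReal.tsum_mul_right, ← ENNReal.tsum_mul_right, ← ENNReal.tsum_add, ENNReal.tsum_prod']
    refine tsum_congr fun i => ?_
    rw [← ENNReal.tsum_mul_left, ← ENNReal.tsum_mul_left, ← ENNReal.tsum_add]
    refine tsum_congr fun l => ?_
    ring
  simp_rw [hsplit]
  have h1 := sq_tsum_pow_mul_le hq α
  have h2 := sq_tsum_pow_mul_le hq β
  have h3 := tsum_sq_tsum_pow_dist_mul_le (q := q) α
  have h4 := tsum_sq_tsum_pow_dist_mul_le (q := q) β
  calc _ ≤ ∑' j : ℕ, 4 * (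
        (∑' i : ℕ, q ^ i * α i) ^ 2 * (∑' l : ℕ, q ^ ((l - j) + (j - l)) * β l) ^ 2 +
        (∑' l : ℕ, q ^ l * β l) ^ 2 * (∑' i : ℕ, q ^ ((i - j) + (j - i)) * α i) ^ 2) := by
        refine ENNReal.tsum_le_tsum fun j => (ennreal_add_sq_le _ _).trans (le_of_eq ?_)
        rw [mul_pow, mul_pow]
    _ = 4 * ((∑' i : ℕ, q ^ i * α i) ^ 2 *
          ∑' j : ℕ, (∑' l : ℕ, q ^ ((l - j) + (j - l)) * β l) ^ 2 +
        (∑' l : ℕ, q ^ l * β l) ^ 2 *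
          ∑' j : ℕ, (∑' i : ℕ, q ^ ((i - j) + (j - i)) * α i) ^ 2) := by
        rw [ENNReal.tsum_mul_left, ENNReal.tsum_add, ENNReal.tsum_mul_left, ENNReal.tsum_mul_left]
    _ ≤ 4 * ((2 * Q * ∑' i, α i ^ 2) * (8 * Q ^ 2 * ∑' l, β l ^ 2) +
        (2 * Q * ∑' i, β i ^ 2) * (8 * Q ^ 2 * ∑' l, α l ^ 2)) := by
        gcongr
    _ = _ := by ring

/-- The decay of the dyadic interactions, as a real inequality. -/
lemma dyadic_kernel_le {s σ : ℝ} (hs : 0 < s) (hσ : 0 ≤ σ) (hσs : σ ≤ s) {j m M l D : ℕ}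
    (hj : j ≤ M + 1) (hD : D ≤ m + 1) (hl : l ≤ m) :
    (2 : ℝ) ^ (σ * j) * (1 + l) ≤
      2 ^ s * 2 ^ (s / 4) / min 1 (2 ^ (s / 2) - 1) *
        (((2 : ℝ) ^ (-(s / 4))) ^ m * ((2 : ℝ) ^ (-(s / 4))) ^ D) *
        ((2 : ℝ) ^ (σ * M) * 2 ^ (s * m)) := by
  have h2 : (0 : ℝ) < 2 := two_pos
  set δ : ℝ := 2 ^ (s / 2) - 1 with hδ
  have hδ0 : 0 < δ := sub_pos.2 (Real.one_lt_rpow one_lt_two (by linarith))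
  set μ := min 1 δ with hμ
  have hμ0 : 0 < μ := lt_min one_pos hδ0
  -- Bernoulli's inequality for `(1 + δ)^m` with `1 + δ = 2^{s/2}`.
  have hbern : μ * (1 + m) ≤ (2 : ℝ) ^ (s / 2 * m) := by
    have h1 := one_add_mul_le_pow (a := δ) (by linarith) m
    rw [hδ, add_sub_cancel, ← Real.rpow_natCast, ← Real.rpow_mul h2.le] at h1
    refine le_trans ?_ h1
    have : μ ≤ 1 := min_le_left _ _
    have h3 : μ ≤ δ := min_le_right _ _
    have h4 : (m : ℝ) * μ ≤ m * δ := by gcongr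
    rw [← hδ]
    linarith
  have hσj : (2 : ℝ) ^ (σ * j) ≤ 2 ^ s * 2 ^ (σ * M) := by
    rw [← Real.rpow_add h2]
    refine Real.rpow_le_rpow_of_exponent_le one_le_two ?_
    have : (j : ℝ) ≤ M + 1 := by exact_mod_cast hj
    nlinarith
  -- The exponent `s m` is spent as follows: `s/2` on the logarithm, `s/4` on decay in `m`, and
  -- `s/4` on decay in `D`. The constant `2^{s/4}` pays for `D ≤ m + 1`.
  have hexp : (2 : ℝ) ^ (s / 2 * m) ≤ 2 ^ (s / 4) *
      (((2 : ℝ) ^ (-(s / 4))) ^ m * ((2 : ℝ) ^ (-(s / 4))) ^ D) * 2 ^ (s * m) := by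
    rw [← Real.rpow_natCast, ← Real.rpow_natCast, ← Real.rpow_mul h2.le, ← Real.rpow_mul h2.le,
      ← Real.rpow_add h2, ← Real.rpow_add h2, ← Real.rpow_add h2]
    refine Real.rpow_le_rpow_of_exponent_le one_le_two ?_
    have : (D : ℝ) ≤ m + 1 := by exact_mod_cast hD
    nlinarith
  have hl' : (1 + l : ℝ) ≤ (2 : ℝ) ^ (s / 2 * m) / μ := by
    rw [le_div_iff₀ hμ0, mul_comm]
    refine le_trans ?_ hbern
    gcongr
  calc (2 : ℝ) ^ (σ * j) * (1 + l) ≤ (2 ^ s * 2 ^ (σ * M)) * (2 ^ (s / 2 * m) / μ) := by gcongr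
    _ ≤ (2 ^ s * 2 ^ (σ * M)) * ((2 ^ (s / 4) *
      (((2 : ℝ) ^ (-(s / 4))) ^ m * ((2 : ℝ) ^ (-(s / 4))) ^ D) * 2 ^ (s * m)) / μ) := by gcongr
    _ = _ := by ring

lemma two_pow_rpow (j : ℕ) (r : ℝ) :
    ((2 : ℝ≥0∞) ^ j) ^ r = ENNReal.ofReal ((2 : ℝ) ^ (r * j)) := by
  rw [← ENNReal.rpow_natCast, ← ENNReal.rpow_mul, ← ENNReal.ofReal_rpow_of_pos two_pos, mul_comm]
  simp

/-- The decay of the dyadic interactions. -/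
lemma interactionWeight_le {s σ : ℝ} (hs : 0 < s) (hσ : 0 ≤ σ) (hσs : σ ≤ s) (j j₁ j₂ : ℕ) :
    ((2 : ℝ≥0∞) ^ j) ^ σ * interactionWeight j j₁ j₂ ≤
      ENNReal.ofReal (2 ^ s * 2 ^ (s / 4) / min 1 (2 ^ (s / 2) - 1)) *
        (ENNReal.ofReal (2 ^ (-(s / 4))) ^ j₁ *
            ENNReal.ofReal (2 ^ (-(s / 4))) ^ ((j₂ - j) + (j - j₂)) +
          ENNReal.ofReal (2 ^ (-(s / 4))) ^ j₂ *
            ENNReal.ofReal (2 ^ (-(s / 4))) ^ ((j₁ - j) + (j - j₁))) *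
        (((2 : ℝ≥0∞) ^ j₁) ^ σ * ((2 : ℝ≥0∞) ^ j₂) ^ s) := by
  by_cases h : Interacts j j₁ j₂
  swap
  · simp [interactionWeight, h]
  obtain ⟨h1, h2, h3⟩ := h
  have hC : 0 ≤ (2 : ℝ) ^ s * 2 ^ (s / 4) / min 1 (2 ^ (s / 2) - 1) := by
    have : (0 : ℝ) < 2 ^ (s / 2) - 1 := sub_pos.2 (Real.one_lt_rpow one_lt_two (by linarith))
    have : 0 < min (1 : ℝ) (2 ^ (s / 2) - 1) := lt_min one_pos this
    positivity
  have key : ∀ m M D : ℕ, m = min j₁ j₂ → M = max j₁ j₂ → D = (M - j) + (j - M) →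
      (2 : ℝ) ^ (σ * M) * 2 ^ (s * m) ≤ 2 ^ (σ * j₁) * 2 ^ (s * j₂) →
      ((2 : ℝ≥0∞) ^ j) ^ σ * interactionWeight j j₁ j₂ ≤
        ENNReal.ofReal (2 ^ s * 2 ^ (s / 4) / min 1 (2 ^ (s / 2) - 1)) *
        (ENNReal.ofReal (2 ^ (-(s / 4))) ^ m * ENNReal.ofReal (2 ^ (-(s / 4))) ^ D) *
        (((2 : ℝ≥0∞) ^ j₁) ^ σ * ((2 : ℝ≥0∞) ^ j₂) ^ s) := by
    intro m M D hm hM hD hw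
    -- The interaction conditions give `|j - M| ≤ m + 1`: a gap between the output and the higher
    -- input is at most one unless `j < m`, and then `M ≤ m + 1`.
    have hk := dyadic_kernel_le hs hσ hσs (j := j) (m := m) (M := M) (l := min j (min j₁ j₂))
      (D := D) (by omega) (by omega) (by omega)
    have hW : interactionWeight j j₁ j₂ = ENNReal.ofReal (1 + (min j (min j₁ j₂) : ℕ)) := by
      rw [interactionWeight, if_pos ⟨h1, h2, h3⟩, ENNReal.ofReal_add one_pos.le (by positivity)]
      simp [-Nat.cast_min]
    rw [hW, two_pow_rpow, two_pow_rpow, two_pow_rpow, ← ENNReal.ofReal_pow (by positivity),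
      ← ENNReal.ofReal_pow (by positivity), ← ENNReal.ofReal_mul (by positivity),
      ← ENNReal.ofReal_mul (by positivity), ← ENNReal.ofReal_mul hC,
      ← ENNReal.ofReal_mul (by positivity), ← ENNReal.ofReal_mul (mul_nonneg hC (by positivity))]
    refine ENNReal.ofReal_le_ofReal (hk.trans ?_)
    exact mul_le_mul_of_nonneg_left hw (mul_nonneg hC (by positivity))
  rcases le_total j₁ j₂ with hle | hle
  · refine (key j₁ j₂ _ (min_eq_left hle).symm (max_eq_right hle).symm rfl ?_).trans ?_
    -- When `v` carries the higher frequency, moving the larger weight `s ≥ σ` to it only increases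
    -- the right-hand side.
    · rw [← Real.rpow_add two_pos, ← Real.rpow_add two_pos]
      refine Real.rpow_le_rpow_of_exponent_le one_le_two ?_
      have : (j₁ : ℝ) ≤ j₂ := by exact_mod_cast hle
      nlinarith
    · gcongr
      exact le_self_add
  · refine (key j₂ j₁ _ (min_eq_right hle).symm (max_eq_left hle).symm rfl le_rfl).trans ?_
    gcongr
    exact le_add_self

end Summation

/-! ### The bilinear estimate -/

section Main

/-- The short-time bilinear estimate, with the derivative gain `σ ∈ [0, s]` on the first factor. -/
theorem exists_NBO_dxMul_le {s σ : ℝ} (hs : 0 < s) (hσ : 0 ≤ σ) (hσs : σ ≤ s) :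
    ∃ C : ℝ≥0, ∀ T : ℝ, 0 < T → ∀ u v : ℝ → L2T,
      NBO σ T (dxMul u v) ≤ C * FBO σ T u * FBO s T v := by
  set q : ℝ≥0∞ := ENNReal.ofReal (2 ^ (-(s / 4))) with hq
  have hq1 : q < 1 := by
    rw [hq, ENNReal.ofReal_lt_one]
    exact Real.rpow_lt_one_of_one_lt_of_neg one_lt_two (by linarith)
  set Q := ∑' n : ℕ, q ^ n with hQ
  have hQtop : Q ≠ ∞ := by
    rw [hQ, ENNReal.tsum_geometric]
    exact ENNReal.inv_ne_top.2 (tsub_pos_of_lt hq1).ne'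
  set Cs : ℝ≥0∞ := ENNReal.ofReal (2 ^ s * 2 ^ (s / 4) / min 1 (2 ^ (s / 2) - 1)) with hCs
  set K : ℝ≥0∞ := (16 * geomConst * Cs) ^ 2 * (128 * Q ^ 3) with hK
  have hKtop : K ≠ ∞ := by
    refine ENNReal.mul_ne_top (ENNReal.pow_ne_top (ENNReal.mul_ne_top
      (ENNReal.mul_ne_top (by simp) geomConst_ne_top) ENNReal.ofReal_ne_top))
      (ENNReal.mul_ne_top (by simp) (ENNReal.pow_ne_top hQtop))
  refine ⟨(K ^ (1 / 2 : ℝ)).toNNReal, fun T hT u v => ?_⟩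
  rw [ENNReal.coe_toNNReal (ENNReal.rpow_ne_top_of_nonneg (by norm_num) hKtop)]
  have hsq : ∀ (j : ℕ) (r : ℝ) (X : ℝ≥0∞),
      ((2 : ℝ≥0∞) ^ j) ^ (2 * r) * X ^ 2 = (((2 : ℝ≥0∞) ^ j) ^ r * X) ^ 2 := by
    intro j r X
    rw [mul_pow, mul_comm 2 r, ENNReal.rpow_mul]
    norm_cast
  have hF : ∀ (r : ℝ) (w : ℝ → L2T), FBO r T w =
      (∑' j : ℕ, (((2 : ℝ≥0∞) ^ j) ^ r * blockNorm T j w) ^ 2) ^ (1 / 2 : ℝ) := by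
    intro r w
    simp_rw [← hsq]
    rfl
  set α : ℕ → ℝ≥0∞ := fun i => ((2 : ℝ≥0∞) ^ i) ^ σ * blockNorm T i u with hα
  set β : ℕ → ℝ≥0∞ := fun i => ((2 : ℝ≥0∞) ^ i) ^ s * blockNorm T i v with hβ
  rw [hF, hF, NBO, mul_assoc, ← ENNReal.mul_rpow_of_nonneg _ _ (by norm_num),
    ← ENNReal.mul_rpow_of_nonneg _ _ (by norm_num)]
  refine ENNReal.rpow_le_rpow ?_ (by norm_num)
  calc _ ≤ ∑' j : ℕ, (16 * geomConst * Cs * ∑' p : ℕ × ℕ,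
        (q ^ p.1 * q ^ ((p.2 - j) + (j - p.2)) +
          q ^ p.2 * q ^ ((p.1 - j) + (j - p.1))) * (α p.1 * β p.2)) ^ 2 := by
        refine ENNReal.tsum_le_tsum fun j => ?_
        rw [hsq]
        refine pow_le_pow_left' ?_ 2
        calc _ ≤ ((2 : ℝ≥0∞) ^ j) ^ σ * (16 * geomConst * ∑' p : ℕ × ℕ,
              interactionWeight j p.1 p.2 * (blockNorm T p.1 u * blockNorm T p.2 v)) := by
              refine mul_le_mul' le_rfl ?_
              exact iSup_le fun a => iSup_le fun ha => iSup_le fun hb =>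
                DU2norm_dxMul_le hT j ha hb
          _ = 16 * geomConst * ∑' p : ℕ × ℕ, ((2 : ℝ≥0∞) ^ j) ^ σ * interactionWeight j p.1 p.2 *
                (blockNorm T p.1 u * blockNorm T p.2 v) := by
              simp_rw [mul_assoc (((2 : ℝ≥0∞) ^ j) ^ σ)]
              rw [ENNReal.tsum_mul_left]
              ring
          _ ≤ 16 * geomConst * ∑' p : ℕ × ℕ, Cs * ((q ^ p.1 * q ^ ((p.2 - j) + (j - p.2)) +
                q ^ p.2 * q ^ ((p.1 - j) + (j - p.1))) * (α p.1 * β p.2)) := by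
              refine mul_le_mul' le_rfl (ENNReal.tsum_le_tsum fun p => ?_)
              calc _ ≤ Cs * (q ^ p.1 * q ^ ((p.2 - j) + (j - p.2)) +
                    q ^ p.2 * q ^ ((p.1 - j) + (j - p.1))) *
                    (((2 : ℝ≥0∞) ^ p.1) ^ σ * ((2 : ℝ≥0∞) ^ p.2) ^ s) *
                    (blockNorm T p.1 u * blockNorm T p.2 v) :=
                    mul_le_mul' (interactionWeight_le hs hσ hσs j p.1 p.2) le_rfl
                _ = _ := by simp only [hα, hβ]; ring
          _ = _ := by rw [ENNReal.tsum_mul_left]; ring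
    _ = (16 * geomConst * Cs) ^ 2 * ∑' j : ℕ, (∑' p : ℕ × ℕ,
        (q ^ p.1 * q ^ ((p.2 - j) + (j - p.2)) +
          q ^ p.2 * q ^ ((p.1 - j) + (j - p.1))) * (α p.1 * β p.2)) ^ 2 := by
        simp_rw [mul_pow (16 * geomConst * Cs)]
        rw [ENNReal.tsum_mul_left]
    _ ≤ (16 * geomConst * Cs) ^ 2 *
          (128 * Q ^ 3 * ((∑' i, α i ^ 2) * ∑' l, β l ^ 2)) := by
        gcongr
        exact tsum_sq_tsum_kernel_le hq1.le α β
    _ = _ := by rw [hK]; ring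

end Main
end ShortTimeBO

open ShortTimeBO in
theorem mainTheorem5 (s : ℝ) (hs : 0 < s) :
    ∃ C : ℝ≥0, ∀ T : ℝ, 0 < T → T ≤ 1 → ∀ u v : ℝ → L2T,
      NBO s T (dxMul u v) ≤ C * FBO s T u * FBO s T v ∧
      NBO 0 T (dxMul u v) ≤ C * FBO 0 T u * FBO s T v := by
  obtain ⟨C₁, h₁⟩ := exists_NBO_dxMul_le hs hs.le le_rfl
  obtain ⟨C₂, h₂⟩ := exists_NBO_dxMul_le hs le_rfl hs.le
  refine ⟨max C₁ C₂, fun T hT _ u v => ⟨(h₁ T hT u v).trans ?_, (h₂ T hT u v).trans ?_⟩⟩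
  · gcongr
    exact le_max_left _ _
  · gcongr
    exact le_max_right _ _
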